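/- Let $m\ge 1$ be an integer and $q\in(0,2)$. Then there is $L_0=L_0(m,q)>0$ such that for every $L>L_0$ there are constants $\epsilon_1,\delta_0>0$, depending only on $m$, $q$ and $L$, with the following property. Let $S^1=\mathbb R/2\pi\mathbb Z$, let $Q_i=[(i-1)L,iL]\times S^1$ with coordinates $(t,\theta)$, and let $Q=Q_1\cup Q_2\cup Q_3$. Let $u\in C^2(Q,\mathbb R^n)$ be a solution of $$\Delta u=\phi(x,u,\nabla u),\qquad |\phi(x,u,\nabla u)|\le \omega\,(|u|+|\nabla u|),$$ where $\Delta=\partial_t^2+\partial_\theta^2$, $|\nabla u|^2=|\partial_tu|^2+|\partial_\theta u|^2$ and $\omega$ is a nonnegative function on $Q$. For $i=1,2,3$ set $$E_i(u)=\int_{Q_i}|u|^2e^{-2mt}\,dt\,d\theta,\qquad \varphi(t)=\frac1\pi\Big(\int_0^{2\pi}u(t,\theta)\cos m\theta\,d\theta,\ \int_0^{2\pi}u(t,\theta)\sin m\theta\,d\theta\Big),$$ $$\gamma_i(u)=\big|(\varphi'+m\varphi)\big(\tfrac{(2i-1)L}{2}\big)\big|\,e^{-(2i-1)mL/2},\qquad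 \lambda_i(u)=\frac{\gamma_i(u)}{\sqrt{E_i(u)}},$$ with the convention $\lambda_i(u)=0$ when $E_i(u)=0$. If $$\|\omega\|_{L^\infty(Q)}<\delta_0\qquad\text{and}\qquad \min\{\lambda_1(u),\lambda_2(u),\lambda_3(u)\}\le\epsilon_1,$$ then $$E_2(u)\le e^{-qL}\big(E_1(u)+E_3(u)\big).$$ -/

import Mathlib

open MeasureTheory Set

noncomputable section

namespace ThreeCircle

/-! The circle is `ℝ / 2πℤ`.  A function on `[a, b] × S¹` is a function of `(t, θ)` that is
`2π`-periodic in `θ`; integrals over the circle are taken over one period. -/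

/-- The target `ℝⁿ` with its Euclidean norm. -/
abbrev Target (n : ℕ) : Type := EuclideanSpace ℝ (Fin n)

/-- The piece `Q_i = [(i-1)L, iL] × S¹` of the cylinder, `S¹` being represented by one period. -/
def piece (L : ℝ) (i : ℕ) : Set (ℝ × ℝ) :=
  Icc (((i : ℝ) - 1) * L) ((i : ℝ) * L) ×ˢ Icc 0 (2 * Real.pi)

/-- `Q = Q_1 ∪ Q_2 ∪ Q_3`. -/
def cylinder (L : ℝ) : Set (ℝ × ℝ) := piece L 1 ∪ piece L 2 ∪ piece L 3

/-- `u ∈ C²(Q, ℝⁿ)`, where `Q = [0, 3L] × S¹`: twice continuously differentiable up to the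
boundary and periodic in the angle. -/
structure IsC2OnCylinder {n : ℕ} (L : ℝ) (u : ℝ × ℝ → Target n) : Prop where
  contDiffOn : ContDiffOn ℝ 2 u (Icc 0 (3 * L) ×ˢ univ)
  periodic : ∀ t ∈ Icc (0 : ℝ) (3 * L), ∀ θ : ℝ, u (t, θ + 2 * Real.pi) = u (t, θ)

variable {n : ℕ}

/-- `∂u/∂t`. -/
def partialT (u : ℝ × ℝ → Target n) (p : ℝ × ℝ) : Target n :=
  deriv (fun s : ℝ => u (s, p.2)) p.1

/-- `∂u/∂θ`. -/
def partialTheta (u : ℝ × ℝ → Target n) (p : ℝ × ℝ) : Target n :=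
  deriv (fun s : ℝ => u (p.1, s)) p.2

/-- The gradient `∇u = (∂u/∂t, ∂u/∂θ)`. -/
def grad (u : ℝ × ℝ → Target n) (p : ℝ × ℝ) : Target n × Target n :=
  (partialT u p, partialTheta u p)

/-- The Euclidean length `|∇u|`. -/
def gradNorm (u : ℝ × ℝ → Target n) (p : ℝ × ℝ) : ℝ :=
  Real.sqrt (‖partialT u p‖ ^ 2 + ‖partialTheta u p‖ ^ 2)

/-- The Laplacian `∂²u/∂t² + ∂²u/∂θ²` of the flat cylinder. -/
def laplace (u : ℝ × ℝ → Target n) (p : ℝ × ℝ) : Target n :=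
  partialT (partialT u) p + partialTheta (partialTheta u) p

/-- The points of the open cylinder `(0, 3L) × S¹`, each represented exactly once. -/
def openCylinder (L : ℝ) : Set (ℝ × ℝ) := Ioo 0 (3 * L) ×ˢ Ico 0 (2 * Real.pi)

/-- `u` solves `Δu = φ(x, u, ∇u)`, where `|φ(x, u, ∇u)| ≤ ω (|u| + |∇u|)`. -/
structure SolvesWithBound (L : ℝ) (u : ℝ × ℝ → Target n)
    (φ : ℝ × ℝ → Target n → Target n × Target n → Target n) (ω : ℝ × ℝ → ℝ) : Prop where
  equation : ∀ p ∈ openCylinder L, laplace u p = φ p (u p) (grad u p)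
  bound : ∀ p ∈ openCylinder L, ‖φ p (u p) (grad u p)‖ ≤ ω p * (‖u p‖ + gradNorm u p)

/-- `(1/π) ∫_0^{2π} u(t, θ) cos mθ dθ`. -/
def cosCoeff (m : ℕ) (u : ℝ × ℝ → Target n) (t : ℝ) : Target n :=
  (1 / Real.pi) • ∫ θ in (0 : ℝ)..(2 * Real.pi), Real.cos (m * θ) • u (t, θ)

/-- `(1/π) ∫_0^{2π} u(t, θ) sin mθ dθ`. -/
def sinCoeff (m : ℕ) (u : ℝ × ℝ → Target n) (t : ℝ) : Target n :=
  (1 / Real.pi) • ∫ θ in (0 : ℝ)..(2 * Real.pi), Real.sin (m * θ) • u (t, θ)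

/-- `g⁺(u) = f' + m f` for the pair `f` of the cosine and the sine coefficients of order `m`. -/
def gPlus (m : ℕ) (u : ℝ × ℝ → Target n) (t : ℝ) : Target n × Target n :=
  (deriv (cosCoeff m u) t + (m : ℝ) • cosCoeff m u t,
   deriv (sinCoeff m u) t + (m : ℝ) • sinCoeff m u t)

/-- `γ_i(u) = |g⁺(c)| e^{-mc}`, where `c = (2i-1)L/2` is the middle of `[(i-1)L, iL]` and `|·|` is
the Euclidean norm of `ℝⁿ × ℝⁿ`. -/
def gam (m : ℕ) (L : ℝ) (u : ℝ × ℝ → Target n) (i : ℕ) : ℝ :=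
  Real.sqrt (‖(gPlus m u ((2 * (i : ℝ) - 1) * L / 2)).1‖ ^ 2 +
      ‖(gPlus m u ((2 * (i : ℝ) - 1) * L / 2)).2‖ ^ 2) *
    Real.exp (-((m : ℝ) * ((2 * (i : ℝ) - 1) * L / 2)))

/-- `E_i(u) = ∫_{Q_i} |u|² e^{-2mt} dt dθ`. -/
def energy (m : ℕ) (L : ℝ) (u : ℝ × ℝ → Target n) (i : ℕ) : ℝ :=
  ∫ p in piece L i, ‖u p‖ ^ 2 * Real.exp (-(2 * (m : ℝ) * p.1))

open Classical in
/-- `λ_i(u) = γ_i(u) / √E_i(u)`, with the convention `λ_i(u) = 0` when `E_i(u) = 0`. -/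
def lam (m : ℕ) (L : ℝ) (u : ℝ × ℝ → Target n) (i : ℕ) : ℝ :=
  if energy m L u i = 0 then 0 else gam m L u i / Real.sqrt (energy m L u i)

/-- The quantities `Φ_i` satisfy the 3-circle lemma on `Q_1 ∪ Q_2 ∪ Q_3` for `(q, L)`. -/
def SatisfiesThreeCircle (Φ : ℕ → ℝ) (q L : ℝ) : Prop :=
  Φ 2 ≤ Real.exp (-(q * L)) * (Φ 1 + Φ 3)

end ThreeCircle

end

/-!
The proof is quantitative and works on Fourier modes, with no compactness argument, so that the
constants do not depend on the dimension of the target.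

Let `v_k(t)` be the `k`-th Fourier coefficient in `θ` of a component of `u`. It solves
`v_k'' - k² v_k = f_k`, where `f_k` is the `k`-th coefficient of `Δu`. After multiplication by
`e^{-mt}` the homogeneous solutions have the exponents `±|k| - m`, which are integers, and the
exponent `0` occurs only for `|k| = m`. Hence, with `σ = L - 1`, the value at `t` is at most about
`e^{-σ}` times values at points at distance about `σ`, on one side or on both:

* for `|k| > m` because `v(t + σ) + v(t - σ) = 2 cosh(kσ) v(t)` if `f_k = 0`;
* for `|k| < m` because both exponents are at most `-1`, so that the Cauchy data at `t - σ`, read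
  off from the values at `t - σ` and `t - σ + 1`, control `v(t)`;
* for `|k| = m` up to the component of exponent `0`, which is `v' + m v` and is measured by
  `γ_i(u)`.

All errors are `L¹` norms of `f_k` with constants independent of `k`
(`IsModeSolution.weighted_norm_le`). Squaring, summing over `k` by Parseval's identity and
integrating over `t ∈ [L, 2L]` gives `IsStripJet.integral_sliceEnergy_le`. The right-hand side `Δu`
enters only on `[1, 3L - 1] × S¹`, where a Caccioppoli inequality bounds `∫ |Δu|²` by a multiple of
`δ₀² ∫ |u|²` (`HasStripJets.integral_laplace_sq_le`). Altogether
`E₂ ≤ (C L² e^{-2L} + C_L (δ₀² + ε₁²)) (E₁ + E₂ + E₃)` (`IsC2OnCylinder.energy_two_le`). For `q < 2`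
the bracket is at most `e^{-qL} / 2` once `L` is large and `ε₁`, `δ₀` are small, and the share of
`E₂` on the right is absorbed on the left.
-/

noncomputable section

namespace ThreeCircle

/-! ### The fundamental solution of `v'' = k² v` -/

/-- The solution of `S'' = k² S` with `S(0) = 0` and `S'(0) = 1`: `sinh (k r) / k`, or `r` if
`k = 0`. -/
def sinhQuot (k r : ℝ) : ℝ := if k = 0 then r else Real.sinh (k * r) / k

theorem hasDerivAt_sinhQuot (k r : ℝ) : HasDerivAt (sinhQuot k) (Real.cosh (k * r)) r := by
  rcases eq_or_ne k 0 with rfl | hk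
  · have : sinhQuot 0 = fun r => r := by ext r; simp [sinhQuot]
    rw [this]; simpa using hasDerivAt_id' r
  · have : sinhQuot k = fun r => Real.sinh (k * r) / k := by ext r; simp [sinhQuot, hk]
    rw [this]
    have h := (((hasDerivAt_id r).const_mul k).sinh).div_const k
    simp only [id] at h
    exact h.congr_deriv (by field_simp)

theorem hasDerivAt_cosh_mul (k r : ℝ) :
    HasDerivAt (fun r => Real.cosh (k * r)) (k ^ 2 * sinhQuot k r) r := by
  have h := ((hasDerivAt_id r).const_mul k).cosh
  simp only [id] at h
  refine h.congr_deriv ?_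
  rcases eq_or_ne k 0 with rfl | hk
  · simp
  · simp only [sinhQuot, hk, if_false]; field_simp

theorem continuous_sinhQuot (k : ℝ) : Continuous (sinhQuot k) :=
  continuous_iff_continuousAt.2 fun r => (hasDerivAt_sinhQuot k r).continuousAt

@[simp] theorem sinhQuot_zero (k : ℝ) : sinhQuot k 0 = 0 := by simp [sinhQuot]

theorem sinhQuot_mono (k : ℝ) : Monotone (sinhQuot k) :=
  monotone_of_deriv_nonneg (fun r => (hasDerivAt_sinhQuot k r).differentiableAt)
    fun r => by rw [(hasDerivAt_sinhQuot k r).deriv]; exact (Real.cosh_pos _).le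

theorem sinhQuot_neg (k r : ℝ) : sinhQuot k (-r) = -sinhQuot k r := by
  unfold sinhQuot; split_ifs <;> simp [Real.sinh_neg, neg_div]

theorem sinhQuot_nonneg (k : ℝ) {r : ℝ} (hr : 0 ≤ r) : 0 ≤ sinhQuot k r := by
  simpa using sinhQuot_mono k hr

theorem abs_sinhQuot_le (k : ℝ) {r R : ℝ} (h : |r| ≤ R) : |sinhQuot k r| ≤ sinhQuot k R := by
  rw [abs_le, ← sinhQuot_neg]
  rw [abs_le] at h
  exact ⟨sinhQuot_mono k h.1, sinhQuot_mono k h.2⟩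

theorem self_le_sinhQuot {k : ℝ} (hk : 0 ≤ k) {r : ℝ} (hr : 0 ≤ r) : r ≤ sinhQuot k r := by
  unfold sinhQuot; split_ifs with h
  · exact le_rfl
  · have hk' : 0 < k := lt_of_le_of_ne hk (Ne.symm h)
    rw [le_div_iff₀ hk', mul_comm]
    exact Real.self_le_sinh_iff.2 (by positivity)

theorem sinhQuot_le_mul_cosh {k : ℝ} {r : ℝ} (hr : 0 ≤ r) :
    sinhQuot k r ≤ r * Real.cosh (k * r) := by
  have h : ∀ x ∈ interior (Icc 0 r), deriv (sinhQuot k) x ≤ Real.cosh (k * r) := by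
    intro x hx
    rw [interior_Icc] at hx
    rw [(hasDerivAt_sinhQuot k x).deriv, Real.cosh_le_cosh, abs_mul, abs_mul,
      abs_of_pos hx.1, abs_of_nonneg hr]
    exact mul_le_mul_of_nonneg_left hx.2.le (abs_nonneg _)
  have := (convex_Icc 0 r).image_sub_le_mul_sub_of_deriv_le
    (continuous_sinhQuot k).continuousOn
    (fun x _ => (hasDerivAt_sinhQuot k x).differentiableAt.differentiableWithinAt) h
    0 (left_mem_Icc.2 hr) r (right_mem_Icc.2 hr) hr
  simpa [mul_comm] using this

theorem sinhQuot_le_cosh {k : ℝ} (hk : 1 ≤ k) {r : ℝ} (hr : 0 ≤ r) :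
    sinhQuot k r ≤ Real.cosh (k * r) := by
  have hk0 : k ≠ 0 := by linarith
  simp only [sinhQuot, hk0, if_false]
  have h1 : 0 ≤ Real.sinh (k * r) := Real.sinh_nonneg_iff.2 (by positivity)
  exact (div_le_self h1 hk).trans (Real.sinh_lt_cosh _).le

theorem cosh_le_exp {x : ℝ} (hx : 0 ≤ x) : Real.cosh x ≤ Real.exp x := by
  rw [Real.cosh_eq]
  have : Real.exp (-x) ≤ Real.exp x := Real.exp_le_exp.2 (by linarith)
  linarith

theorem exp_le_two_mul_cosh (x : ℝ) : Real.exp x ≤ 2 * Real.cosh x := by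
  rw [Real.cosh_eq]
  have : 0 < Real.exp (-x) := Real.exp_pos _
  linarith

/-! ### Estimates for a single Fourier mode -/

section Mode

/-- `v` solves `v'' - k² v = f` on `(0, b)`, with derivative `v₁` and continuous right-hand side
`f`. -/
structure IsModeSolution (b k : ℝ) (v v₁ f : ℝ → ℂ) : Prop where
  deriv_fst : ∀ t ∈ Ioo 0 b, HasDerivAt v (v₁ t) t
  deriv_snd : ∀ t ∈ Ioo 0 b, HasDerivAt v₁ ((k ^ 2 : ℝ) * v t + f t) t
  cont : ContinuousOn f (Ioo 0 b)

variable {b k : ℝ} {v v₁ f : ℝ → ℂ}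

theorem uIcc_subset_strip {x t : ℝ} (hx : x ∈ Ioo 0 b) (ht : t ∈ Ioo 0 b) :
    uIcc x t ⊆ Ioo 0 b := (ordConnected_Ioo).uIcc_subset hx ht

/-- Variation of constants for `v'' - k² v = f`, with Cauchy data at `x`. -/
theorem IsModeSolution.duhamel (h : IsModeSolution b k v v₁ f) {x t : ℝ} (hx : x ∈ Ioo 0 b)
    (ht : t ∈ Ioo 0 b) :
    v t = (Real.cosh (k * (t - x)) : ℝ) * v x + (sinhQuot k (t - x) : ℝ) * v₁ x +
      ∫ s in x..t, (sinhQuot k (t - s) : ℝ) * f s := by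
  have hsub := uIcc_subset_strip hx ht
  have hd : ∀ s ∈ uIcc x t, HasDerivAt
      (fun s => (Real.cosh (k * (t - s)) : ℂ) * v s + (sinhQuot k (t - s) : ℂ) * v₁ s)
      ((sinhQuot k (t - s) : ℝ) * f s) s := by
    intro s hs
    have e1 : HasDerivAt (fun s => (Real.cosh (k * (t - s)) : ℂ))
        ((-(k ^ 2 * sinhQuot k (t - s)) : ℝ) : ℂ) s := by
      have := (hasDerivAt_cosh_mul k (t - s)).comp_const_sub t s
      exact this.ofReal_comp
    have e2 : HasDerivAt (fun s => (sinhQuot k (t - s) : ℂ))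
        ((-(Real.cosh (k * (t - s))) : ℝ) : ℂ) s := by
      have := (hasDerivAt_sinhQuot k (t - s)).comp_const_sub t s
      exact this.ofReal_comp
    refine ((e1.mul (h.deriv_fst s (hsub hs))).add
      (e2.mul (h.deriv_snd s (hsub hs)))).congr_deriv ?_
    push_cast
    ring
  have hc : ContinuousOn (fun s => ((sinhQuot k (t - s) : ℝ) : ℂ) * f s) (uIcc x t) :=
    (Complex.continuous_ofReal.comp ((continuous_sinhQuot k).comp
      (continuous_const.sub continuous_id))).continuousOn.mul (h.cont.mono hsub)
  rw [intervalIntegral.integral_eq_sub_of_hasDerivAt hd hc.intervalIntegrable]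
  simp

theorem IsModeSolution.norm_integral_le (h : IsModeSolution b k v v₁ f) {x t y z : ℝ}
    (hy : y ∈ Ioo 0 b) (hz : z ∈ Ioo 0 b)
    (hx : x ∈ Icc y z) (ht : t ∈ Icc y z) {g : ℝ → ℝ} {M : ℝ}
    (hM : ∀ s ∈ uIcc x t, |g s| ≤ M) :
    ‖∫ s in x..t, (g s : ℝ) * f s‖ ≤ M * ∫ s in y..z, ‖f s‖ := by
  have hyz : y ≤ z := hx.1.trans hx.2
  have hM0 : 0 ≤ M := (abs_nonneg _).trans (hM x left_mem_uIcc)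
  have hsub : uIcc x t ⊆ Icc y z := ordConnected_Icc.uIcc_subset hx ht
  have hsub' : Icc y z ⊆ Ioo 0 b := by
    have := uIcc_subset_strip hy hz
    rwa [uIcc_of_le hyz] at this
  have hfc : ContinuousOn (fun s => ‖f s‖) (Icc y z) := (h.cont.mono hsub').norm
  have hfi : IntegrableOn (fun s => ‖f s‖) (Icc y z) := hfc.integrableOn_Icc
  have hsub2 : uIoc x t ⊆ Icc y z := uIoc_subset_uIcc.trans hsub
  rw [intervalIntegral.norm_intervalIntegral_eq, intervalIntegral.integral_of_le hyz,
    ← integral_Icc_eq_integral_Ioc, ← integral_const_mul]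
  calc ‖∫ s in uIoc x t, (g s : ℂ) * f s‖ ≤ ∫ s in uIoc x t, M * ‖f s‖ := by
        refine norm_integral_le_of_norm_le ((hfi.mono_set hsub2).const_mul M) ?_
        filter_upwards [ae_restrict_mem measurableSet_uIoc] with s hs
        rw [norm_mul, Complex.norm_real]
        exact mul_le_mul_of_nonneg_right (hM s (uIoc_subset_uIcc hs)) (norm_nonneg _)
    _ ≤ ∫ s in Icc y z, M * ‖f s‖ := by
        refine setIntegral_mono_set (hfi.const_mul M) ?_ hsub2.eventuallyLE
        exact Filter.Eventually.of_forall fun s => by positivity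


theorem integral_norm_nonneg (f : ℝ → ℂ) {y z : ℝ} (h : y ≤ z) : 0 ≤ ∫ s in y..z, ‖f s‖ :=
  intervalIntegral.integral_nonneg h fun _ _ => norm_nonneg _

/-- Interpolation between `t - σ` and `t + σ`: the Duhamel formulas at the two points are added, so
that the derivative at `t` cancels. -/
theorem IsModeSolution.norm_symm_le (h : IsModeSolution b k v v₁ f) (hk : 1 ≤ k) {t σ : ℝ}
    (hσ : 0 ≤ σ) {y z : ℝ} (hy : y ∈ Ioo 0 b) (hz : z ∈ Ioo 0 b) (h1 : y ≤ t - σ)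
    (h2 : t + σ ≤ z) :
    2 * Real.cosh (k * σ) * ‖v t‖ ≤ ‖v (t + σ)‖ + ‖v (t - σ)‖ +
      2 * Real.cosh (k * σ) * ∫ s in y..z, ‖f s‖ := by
  have hIcc : ∀ s, s ∈ Icc y z → s ∈ Ioo 0 b := fun s hs =>
    ⟨hy.1.trans_le hs.1, hs.2.trans_lt hz.2⟩
  have ht : t ∈ Icc y z := ⟨by linarith, by linarith⟩
  have hp : t + σ ∈ Icc y z := ⟨by linarith, by linarith⟩
  have hm : t - σ ∈ Icc y z := ⟨by linarith, by linarith⟩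
  have dp := h.duhamel (hIcc _ ht) (hIcc _ hp)
  have dm := h.duhamel (hIcc _ ht) (hIcc _ hm)
  have hS : sinhQuot k σ ≤ Real.cosh (k * σ) := sinhQuot_le_cosh hk hσ
  have np := h.norm_integral_le hy hz ht hp (g := fun s => sinhQuot k (t + σ - s))
    (M := Real.cosh (k * σ)) (fun s hs => by
      refine (abs_sinhQuot_le k ?_).trans hS
      rw [uIcc_of_le (by linarith)] at hs
      rw [abs_le]; constructor <;> linarith [hs.1, hs.2])
  have nm := h.norm_integral_le hy hz ht hm (g := fun s => sinhQuot k (t - σ - s))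
    (M := Real.cosh (k * σ)) (fun s hs => by
      refine (abs_sinhQuot_le k ?_).trans hS
      rw [uIcc_of_ge (by linarith)] at hs
      rw [abs_le]; constructor <;> linarith [hs.1, hs.2])
  have e1 : t + σ - t = σ := by ring
  have e2 : t - σ - t = -σ := by ring
  rw [e1] at dp
  rw [e2, sinhQuot_neg, mul_neg, Real.cosh_neg] at dm
  set I₁ := ∫ s in t..(t + σ), ((sinhQuot k (t + σ - s) : ℝ) : ℂ) * f s
  set I₂ := ∫ s in t..(t - σ), ((sinhQuot k (t - σ - s) : ℝ) : ℂ) * f s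
  -- the terms with `v₁ t` cancel, since `sinhQuot` is odd
  have key : ((2 * Real.cosh (k * σ) : ℝ) : ℂ) * v t = v (t + σ) + v (t - σ) - I₁ - I₂ := by
    rw [dp, dm]; push_cast; ring
  have hn := congrArg norm key
  rw [norm_mul, Complex.norm_real, Real.norm_of_nonneg
    (by have := Real.cosh_pos (k * σ); positivity)] at hn
  rw [hn]
  have a1 := norm_sub_le (v (t + σ) + v (t - σ) - I₁) I₂
  have a2 := norm_sub_le (v (t + σ) + v (t - σ)) I₁
  have a3 := norm_add_le (v (t + σ)) (v (t - σ))
  linarith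

/-- Extrapolation from `t - σ` and `t - σ + 1` to `t`. The two values replace the Cauchy data at
`t - σ`. -/
theorem IsModeSolution.norm_le_of_left (h : IsModeSolution b k v v₁ f) (hk : 0 ≤ k) {t σ : ℝ}
    (hσ : 1 ≤ σ) {y z : ℝ} (hy : y ∈ Ioo 0 b) (hz : z ∈ Ioo 0 b) (h1 : y ≤ t - σ) (h2 : t ≤ z) :
    ‖v t‖ ≤ σ * Real.exp (k * σ) * ((1 + Real.exp k) * ‖v (t - σ)‖ + ‖v (t - σ + 1)‖ +
      2 * ∫ s in y..z, ‖f s‖) := by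
  have hIcc : ∀ s, s ∈ Icc y z → s ∈ Ioo 0 b := fun s hs =>
    ⟨hy.1.trans_le hs.1, hs.2.trans_lt hz.2⟩
  have ht : t ∈ Icc y z := ⟨by linarith, by linarith⟩
  have hx : t - σ ∈ Icc y z := ⟨by linarith, by linarith⟩
  have hx1 : t - σ + 1 ∈ Icc y z := ⟨by linarith, by linarith⟩
  have d1 := h.duhamel (hIcc _ hx) (hIcc _ ht)
  have d2 := h.duhamel (hIcc _ hx) (hIcc _ hx1)
  have n1 := h.norm_integral_le hy hz hx ht (g := fun s => sinhQuot k (t - s))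
    (M := sinhQuot k σ) (fun s hs => by
      refine abs_sinhQuot_le k ?_
      rw [uIcc_of_le (by linarith)] at hs
      rw [abs_le]; constructor <;> linarith [hs.1, hs.2])
  have n2 := h.norm_integral_le hy hz hx hx1 (g := fun s => sinhQuot k (t - σ + 1 - s))
    (M := sinhQuot k 1) (fun s hs => by
      refine abs_sinhQuot_le k ?_
      rw [uIcc_of_le (by linarith)] at hs
      rw [abs_le]; constructor <;> linarith [hs.1, hs.2])
  have e1 : t - (t - σ) = σ := by ring
  have e2 : t - σ + 1 - (t - σ) = 1 := by ring
  rw [e1] at d1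
  rw [e2, mul_one] at d2
  set I₁ := ∫ s in (t - σ)..t, ((sinhQuot k (t - s) : ℝ) : ℂ) * f s
  set I₂ := ∫ s in (t - σ)..(t - σ + 1), ((sinhQuot k (t - σ + 1 - s) : ℝ) : ℂ) * f s
  set J := ∫ s in y..z, ‖f s‖
  have hJ : 0 ≤ J := integral_norm_nonneg f (by linarith)
  have hS1 : 1 ≤ sinhQuot k 1 := self_le_sinhQuot hk zero_le_one
  have hcσ : Real.cosh (k * σ) ≤ Real.exp (k * σ) := cosh_le_exp (by positivity)
  have hc1 : Real.cosh k ≤ Real.exp k := cosh_le_exp hk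
  have hSσ : sinhQuot k σ ≤ σ * Real.exp (k * σ) :=
    (sinhQuot_le_mul_cosh (by linarith)).trans (mul_le_mul_of_nonneg_left hcσ (by linarith))
  -- the derivative at `t - σ` from the values at `t - σ` and `t - σ + 1`
  have hv1 : ‖v₁ (t - σ)‖ ≤ ‖v (t - σ + 1)‖ + Real.exp k * ‖v (t - σ)‖ + J := by
    have key : ((sinhQuot k 1 : ℝ) : ℂ) * v₁ (t - σ) =
        v (t - σ + 1) - (Real.cosh k : ℝ) * v (t - σ) - I₂ := by rw [d2]; ring
    have hn := congrArg norm key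
    rw [norm_mul, Complex.norm_real, Real.norm_of_nonneg (by linarith)] at hn
    have a1 := norm_sub_le (v (t - σ + 1) - (Real.cosh k : ℝ) * v (t - σ)) I₂
    have a2 := norm_sub_le (v (t - σ + 1)) ((Real.cosh k : ℝ) * v (t - σ))
    rw [norm_mul, Complex.norm_real, Real.norm_of_nonneg (Real.cosh_pos k).le] at a2
    have a3 : Real.cosh k * ‖v (t - σ)‖ ≤ Real.exp k * ‖v (t - σ)‖ :=
      mul_le_mul_of_nonneg_right hc1 (norm_nonneg _)
    have hX : 0 ≤ ‖v (t - σ + 1)‖ + Real.exp k * ‖v (t - σ)‖ := by positivity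
    have hX' : ‖v (t - σ + 1)‖ + Real.exp k * ‖v (t - σ)‖ ≤
        sinhQuot k 1 * (‖v (t - σ + 1)‖ + Real.exp k * ‖v (t - σ)‖) :=
      le_mul_of_one_le_left hX hS1
    have : sinhQuot k 1 * ‖v₁ (t - σ)‖ ≤
        sinhQuot k 1 * (‖v (t - σ + 1)‖ + Real.exp k * ‖v (t - σ)‖ + J) := by
      rw [mul_add (sinhQuot k 1)]
      linarith
    exact le_of_mul_le_mul_left this (by linarith)
  have hn : ‖v t‖ ≤ Real.cosh (k * σ) * ‖v (t - σ)‖ + sinhQuot k σ * ‖v₁ (t - σ)‖ + ‖I₁‖ := by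
    rw [d1]
    refine (norm_add_le _ _).trans (add_le_add_left ((norm_add_le _ _).trans ?_) _)
    rw [norm_mul, norm_mul, Complex.norm_real, Complex.norm_real,
      Real.norm_of_nonneg (Real.cosh_pos _).le,
      Real.norm_of_nonneg (sinhQuot_nonneg k (by linarith))]
  set K := σ * Real.exp (k * σ)
  have hK : Real.cosh (k * σ) ≤ K := hcσ.trans
    (le_mul_of_one_le_left (Real.exp_pos _).le hσ)
  have hK0 : 0 ≤ K := by positivity
  calc ‖v t‖ ≤ K * ‖v (t - σ)‖ +
        K * (‖v (t - σ + 1)‖ + Real.exp k * ‖v (t - σ)‖ + J) + K * J := by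
        refine hn.trans (add_le_add (add_le_add ?_ ?_) ?_)
        · gcongr
        · exact mul_le_mul hSσ hv1 (norm_nonneg _) hK0
        · exact n1.trans (by gcongr)
    _ = _ := by ring

/-- The mode of weight exponent `0`. The quantity `g = v' + k v` satisfies `g' = k g + f`, so that
`e^{-kt} g` is constant up to the integral of `f` and may be measured at any point `c`; then `v` is
recovered from `v' + k v = g`, which forgets its initial value at the rate `e^{-kσ}`. -/
theorem IsModeSolution.norm_le_of_resonant (h : IsModeSolution b k v v₁ f) (hk : 0 ≤ k)
    {t σ c : ℝ} (hσ : 0 ≤ σ) {y z : ℝ} (hy : y ∈ Ioo 0 b) (hz : z ∈ Ioo 0 b) (h1 : y ≤ t - σ)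
    (h2 : t ≤ z) (hc : c ∈ Icc y z) :
    Real.exp (-(k * t)) * ‖v t‖ ≤
      Real.exp (-(2 * k * σ)) * (Real.exp (-(k * (t - σ))) * ‖v (t - σ)‖) +
      σ * (Real.exp (-(k * c)) * ‖v₁ c + k * v c‖ + ∫ s in y..z, ‖f s‖) := by
  have hIcc : ∀ s, s ∈ Icc y z → s ∈ Ioo 0 b := fun s hs =>
    ⟨hy.1.trans_le hs.1, hs.2.trans_lt hz.2⟩
  have ht : t ∈ Icc y z := ⟨by linarith, by linarith⟩
  have hx : t - σ ∈ Icc y z := ⟨by linarith, by linarith⟩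
  set J := ∫ s in y..z, ‖f s‖
  have hexp : ∀ a s : ℝ, HasDerivAt (fun s => (Real.exp (a * s) : ℂ))
      ((Real.exp (a * s) * a : ℝ) : ℂ) s := fun a s => by
    have := (((hasDerivAt_id s).const_mul a).exp).ofReal_comp
    simpa using this
  -- `e^{-ks} (v' + k v)` changes by at most the integral of `f`
  have hg : ∀ s ∈ Icc y z, Real.exp (-k * s) * ‖v₁ s + k * v s‖ ≤
      Real.exp (-(k * c)) * ‖v₁ c + k * v c‖ + J := by
    intro s hs
    have hsub : uIcc c s ⊆ Ioo 0 b := uIcc_subset_strip (hIcc _ hc) (hIcc _ hs)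
    have hd : ∀ r ∈ uIcc c s, HasDerivAt
        (fun r => (Real.exp (-k * r) : ℂ) * (v₁ r + k * v r))
        ((Real.exp (-k * r) : ℝ) * f r) r := by
      intro r hr
      refine ((hexp (-k) r).mul ((h.deriv_snd r (hsub hr)).add
        ((h.deriv_fst r (hsub hr)).const_mul (k : ℂ)))).congr_deriv ?_
      simp only [Pi.add_apply]
      push_cast
      ring
    have hcf : ContinuousOn (fun r => ((Real.exp (-k * r) : ℝ) : ℂ) * f r) (uIcc c s) := by
      refine ContinuousOn.mul (Continuous.continuousOn ?_) (h.cont.mono hsub)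
      fun_prop
    have hI := intervalIntegral.integral_eq_sub_of_hasDerivAt hd hcf.intervalIntegrable
    have hb := h.norm_integral_le hy hz hc hs (g := fun r => Real.exp (-k * r)) (M := 1)
      (fun r hr => by
        rw [abs_of_pos (Real.exp_pos _), Real.exp_le_one_iff]
        have := (hsub hr).1
        nlinarith)
    rw [hI, one_mul] at hb
    have := norm_le_norm_add_norm_sub' ((Real.exp (-k * s) : ℂ) * (v₁ s + k * v s))
      ((Real.exp (-k * c) : ℂ) * (v₁ c + k * v c))
    simp only [norm_mul, Complex.norm_real, Real.norm_of_nonneg (Real.exp_pos _).le] at this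
    simp only [neg_mul] at this hb ⊢
    linarith
  set G := Real.exp (-(k * c)) * ‖v₁ c + k * v c‖ + J
  have hsub : uIcc (t - σ) t ⊆ Icc y z := ordConnected_Icc.uIcc_subset hx ht
  have hd : ∀ r ∈ uIcc (t - σ) t, HasDerivAt
      (fun r => (Real.exp (k * r) : ℂ) * v r)
      ((Real.exp (k * r) : ℝ) * (v₁ r + k * v r)) r := by
    intro r hr
    refine ((hexp k r).mul (h.deriv_fst r (hIcc _ (hsub hr)))).congr_deriv ?_
    push_cast
    ring
  have hcf : ContinuousOn (fun r => ((Real.exp (k * r) : ℝ) : ℂ) * (v₁ r + k * v r))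
      (uIcc (t - σ) t) := by
    refine ContinuousOn.mul (Continuous.continuousOn ?_) (ContinuousOn.add ?_
      (continuousOn_const.mul ?_))
    · fun_prop
    · exact fun r hr => (h.deriv_snd r (hIcc _ (hsub hr))).continuousAt.continuousWithinAt
    · exact fun r hr => (h.deriv_fst r (hIcc _ (hsub hr))).continuousAt.continuousWithinAt
  have hI := intervalIntegral.integral_eq_sub_of_hasDerivAt hd hcf.intervalIntegrable
  have hb : ‖∫ r in (t - σ)..t, ((Real.exp (k * r) : ℝ) : ℂ) * (v₁ r + k * v r)‖ ≤
      (Real.exp (2 * k * t) * G) * |t - (t - σ)| := by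
    refine intervalIntegral.norm_integral_le_of_norm_le_const fun r hr => ?_
    have hr' := hsub (uIoc_subset_uIcc hr)
    rw [uIoc_of_le (by linarith)] at hr
    rw [norm_mul, Complex.norm_real, Real.norm_of_nonneg (Real.exp_pos _).le]
    have e : Real.exp (k * r) = Real.exp (2 * k * r) * Real.exp (-k * r) := by
      rw [← Real.exp_add]; congr 1; ring
    rw [e, mul_assoc]
    refine mul_le_mul (Real.exp_le_exp.2 ?_) (hg r hr') (by positivity) (Real.exp_pos _).le
    have := hr.2
    nlinarith
  rw [hI, sub_sub_cancel, abs_of_nonneg hσ] at hb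
  have := norm_le_norm_add_norm_sub' ((Real.exp (k * t) : ℂ) * v t)
      ((Real.exp (k * (t - σ)) : ℂ) * v (t - σ))
  simp only [norm_mul, Complex.norm_real, Real.norm_of_nonneg (Real.exp_pos _).le] at this
  have h3 := mul_le_mul_of_nonneg_left (this.trans (add_le_add_right hb _))
    (Real.exp_pos (-(2 * k * t))).le
  calc Real.exp (-(k * t)) * ‖v t‖ = Real.exp (-(2 * k * t)) * (Real.exp (k * t) * ‖v t‖) := by
        rw [← mul_assoc, ← Real.exp_add]; congr 2; ring
    _ ≤ _ := h3
    _ = _ := by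
        have e1 : Real.exp (-(2 * k * t)) * Real.exp (2 * k * t) = 1 := by
          rw [← Real.exp_add]; simp
        have e2 : Real.exp (-(2 * k * t)) * Real.exp (k * (t - σ)) =
            Real.exp (-(2 * k * σ)) * Real.exp (-(k * (t - σ))) := by
          rw [← Real.exp_add, ← Real.exp_add]; congr 1; ring
        linear_combination ‖v (t - σ)‖ * e2 + G * σ * e1

/-- One estimate for all modes, with constants independent of the order `K`. The last term is
present only for the mode `K = m`. -/
theorem IsModeSolution.weighted_norm_le {m K : ℕ} (hm : 1 ≤ m)
    (h : IsModeSolution b K v v₁ f) {t σ c : ℝ} (hσ : 1 ≤ σ) {y z : ℝ} (hy : y ∈ Ioo 0 b)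
    (hz : z ∈ Ioo 0 b) (h1 : y ≤ t - σ) (h2 : t + σ ≤ z) (hc : c ∈ Icc y z) :
    Real.exp (-(m * t)) * ‖v t‖ ≤
      2 * Real.exp m * σ * Real.exp (-σ) * (Real.exp (-(m * (t - σ))) * ‖v (t - σ)‖ +
        Real.exp (-(m * (t - σ + 1))) * ‖v (t - σ + 1)‖ +
        Real.exp (-(m * (t + σ))) * ‖v (t + σ)‖) +
      2 * σ * ((∫ s in y..z, ‖f s‖) +
        if K = m then Real.exp (-(m * c)) * ‖v₁ c + m * v c‖ else 0) := by
  set J := ∫ s in y..z, ‖f s‖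
  have hJ : 0 ≤ J := integral_norm_nonneg f (by linarith)
  have hm' : (1 : ℝ) ≤ m := by exact_mod_cast hm
  have hem : 1 ≤ Real.exp m := Real.one_le_exp (by positivity)
  have hκ : Real.exp (-σ) ≤ 2 * Real.exp m * σ * Real.exp (-σ) := by
    refine le_mul_of_one_le_left (Real.exp_pos _).le ?_
    nlinarith
  set W₁ := Real.exp (-(m * (t - σ))) * ‖v (t - σ)‖ with hW₁
  set W₂ := Real.exp (-(m * (t - σ + 1))) * ‖v (t - σ + 1)‖ with hW₂
  set W₃ := Real.exp (-(m * (t + σ))) * ‖v (t + σ)‖ with hW₃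
  have p₁ : 0 ≤ W₁ := by positivity
  have p₂ : 0 ≤ W₂ := by positivity
  have p₃ : 0 ≤ W₃ := by positivity
  -- below `m`: extrapolation from the left; at `m`: the resonant estimate; above: interpolation
  rcases lt_trichotomy K m with hK | hK | hK
  · rw [if_neg hK.ne, add_zero]
    have hK' : (K : ℝ) ≤ m - 1 := by
      have : (K : ℝ) + 1 ≤ m := by exact_mod_cast hK
      linarith
    have key := h.norm_le_of_left (Nat.cast_nonneg K) hσ hy hz h1 (by linarith)
    have hx0 : 0 ≤ t - σ := hy.1.le.trans h1
    calc Real.exp (-(m * t)) * ‖v t‖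
        ≤ Real.exp (-(m * t)) * (σ * Real.exp ((m - 1) * σ) *
          ((1 + Real.exp m) * ‖v (t - σ)‖ + ‖v (t - σ + 1)‖ + 2 * J)) := by
          refine mul_le_mul_of_nonneg_left (key.trans ?_) (Real.exp_pos _).le
          gcongr
      _ = σ * Real.exp (-σ) * ((1 + Real.exp m) * W₁ + Real.exp m * W₂ +
          2 * (Real.exp (-(m * (t - σ))) * J)) := by
          have e1 : Real.exp (-(m * t)) * Real.exp ((m - 1) * σ) =
              Real.exp (-σ) * Real.exp (-(m * (t - σ))) := by
            rw [← Real.exp_add, ← Real.exp_add]; congr 1; ring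
          have e2 : Real.exp (-(m * (t - σ))) =
              Real.exp m * Real.exp (-(m * (t - σ + 1))) := by
            rw [← Real.exp_add]; congr 1; ring
          rw [hW₁, hW₂]
          linear_combination (σ * ((1 + Real.exp m) * ‖v (t - σ)‖ + ‖v (t - σ + 1)‖ + 2 * J)) * e1
            + (σ * Real.exp (-σ) * ‖v (t - σ + 1)‖) * e2
      _ ≤ σ * Real.exp (-σ) * (2 * Real.exp m * (W₁ + W₂ + W₃) + 2 * J) := by
          refine mul_le_mul_of_nonneg_left ?_ (by positivity)
          have a1 : (1 + Real.exp m) * W₁ ≤ 2 * Real.exp m * W₁ := by gcongr; linarith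
          have a2 : Real.exp (-(m * (t - σ))) * J ≤ J :=
            mul_le_of_le_one_left hJ (Real.exp_le_one_iff.2 (by
              rw [neg_nonpos]; positivity))
          have a3 : 0 ≤ Real.exp m * W₂ := by positivity
          have a4 : 0 ≤ Real.exp m * W₃ := by positivity
          linarith
      _ ≤ _ := by
          have : Real.exp (-σ) * (σ * J) ≤ σ * J :=
            mul_le_of_le_one_left (by positivity) (Real.exp_le_one_iff.2 (by linarith))
          linarith
  · rw [if_pos hK]
    subst hK
    set Γ := Real.exp (-(K * c)) * ‖v₁ c + K * v c‖
    have hΓ : 0 ≤ Γ := by positivity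
    have key := h.norm_le_of_resonant (Nat.cast_nonneg K) (by linarith) hy hz h1 (by linarith) hc
    simp only [Complex.ofReal_natCast] at key
    have a1 : Real.exp (-(2 * K * σ)) * W₁ ≤
        2 * Real.exp K * σ * Real.exp (-σ) * (W₁ + W₂ + W₃) := by
      refine mul_le_mul ((Real.exp_le_exp.2 ?_).trans hκ) (by linarith) p₁ (by positivity)
      nlinarith
    have a2 : 0 ≤ σ * (Γ + J) := by positivity
    linarith
  · rw [if_neg hK.ne', add_zero]
    have hK' : (m : ℝ) + 1 ≤ K := by exact_mod_cast hK
    have key := h.norm_symm_le (by linarith) (by linarith) hy hz h1 h2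
    set D := 2 * Real.cosh (K * σ)
    have hD : 0 < D := by have := Real.cosh_pos (K * σ); positivity
    have hDe : Real.exp ((m + 1) * σ) ≤ D :=
      (Real.exp_le_exp.2 (by gcongr)).trans (exp_le_two_mul_cosh _)
    have b1 : ‖v t‖ ≤ Real.exp (-((m + 1) * σ)) * (‖v (t + σ)‖ + ‖v (t - σ)‖) + J := by
      have : D * ‖v t‖ ≤ D * (Real.exp (-((m + 1) * σ)) * (‖v (t + σ)‖ + ‖v (t - σ)‖) + J) := by
        have h3 : 1 ≤ D * Real.exp (-((m + 1) * σ)) := by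
          rw [Real.exp_neg, ← div_eq_mul_inv, one_le_div (Real.exp_pos _)]
          exact hDe
        have h4 := le_mul_of_one_le_left
          (by positivity : 0 ≤ ‖v (t + σ)‖ + ‖v (t - σ)‖) h3
        linarith
      exact le_of_mul_le_mul_left this hD
    have b2 := mul_le_mul_of_nonneg_left b1 (Real.exp_pos (-(m * t))).le
    have ht0 : 0 ≤ t := by linarith [hy.1]
    have c1 : Real.exp (-(m * t)) * Real.exp (-((m + 1) * σ)) ≤
        Real.exp (-σ) * Real.exp (-(m * (t + σ))) := by
      rw [← Real.exp_add, ← Real.exp_add]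
      exact Real.exp_le_exp.2 (by linarith)
    have c2 : Real.exp (-(m * t)) * Real.exp (-((m + 1) * σ)) ≤
        Real.exp (-σ) * Real.exp (-(m * (t - σ))) := by
      rw [← Real.exp_add, ← Real.exp_add]
      refine Real.exp_le_exp.2 ?_
      nlinarith
    have c3 : Real.exp (-(m * t)) * J ≤ J :=
      mul_le_of_le_one_left hJ (Real.exp_le_one_iff.2 (by rw [neg_nonpos]; positivity))
    have d1 := mul_le_mul_of_nonneg_right c1 (norm_nonneg (v (t + σ)))
    have d2 := mul_le_mul_of_nonneg_right c2 (norm_nonneg (v (t - σ)))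
    have e1 : Real.exp (-σ) * (W₁ + W₂ + W₃) ≤
        2 * Real.exp m * σ * Real.exp (-σ) * (W₁ + W₂ + W₃) :=
      mul_le_mul_of_nonneg_right hκ (by linarith)
    have e2 : 0 ≤ Real.exp (-σ) * W₂ := by positivity
    have e3 : J ≤ 2 * σ * J := le_mul_of_one_le_left hJ (by linarith)
    simp only [hW₁, hW₂, hW₃] at e1 e2 ⊢
    linarith

end Mode

/-! ### Integrals over the circle -/

theorem continuousOn_circleIntegral {E : Type*} [NormedAddCommGroup E] [NormedSpace ℝ E]
    {s : Set ℝ} [LocallyCompactSpace s] {F : ℝ × ℝ → E} (hF : ContinuousOn F (s ×ˢ univ)) :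
    ContinuousOn (fun t => ∫ θ in (0 : ℝ)..(2 * Real.pi), F (t, θ)) s := by
  rw [continuousOn_iff_continuous_domRestrict]
  have hc : Continuous (Function.uncurry fun (t : s) (θ : ℝ) => F (t, θ)) := by
    refine hF.comp_continuous (f := fun q : s × ℝ => ((q.1 : ℝ), q.2)) (by fun_prop) ?_
    rintro ⟨t, θ⟩
    exact ⟨t.2, mem_univ _⟩
  have := continuous_parametric_integral_of_continuous (μ := volume) hc
    (isCompact_Icc (a := (0 : ℝ)) (b := 2 * Real.pi))
  refine this.congr fun t => ?_
  simp only [domRestrict_apply]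
  rw [intervalIntegral.integral_of_le Real.two_pi_pos.le, integral_Icc_eq_integral_Ioc]

theorem continuous_slice {E : Type*} [TopologicalSpace E] {s : Set ℝ} {F : ℝ × ℝ → E}
    (hF : ContinuousOn F (s ×ˢ univ)) {t : ℝ} (ht : t ∈ s) : Continuous fun θ => F (t, θ) :=
  hF.comp_continuous (by fun_prop) fun _ => ⟨ht, mem_univ _⟩

theorem hasDerivAt_circleIntegral {E : Type*} [NormedAddCommGroup E] [NormedSpace ℝ E]
    {b : ℝ} {F F' : ℝ × ℝ → E} (hF : ContinuousOn F (Ioo 0 b ×ˢ univ))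
    (hF' : ContinuousOn F' (Ioo 0 b ×ˢ univ))
    (hd : ∀ t ∈ Ioo 0 b, ∀ θ, HasDerivAt (fun s => F (s, θ)) (F' (t, θ)) t)
    {t : ℝ} (ht : t ∈ Ioo 0 b) :
    HasDerivAt (fun s => ∫ θ in (0 : ℝ)..(2 * Real.pi), F (s, θ))
      (∫ θ in (0 : ℝ)..(2 * Real.pi), F' (t, θ)) t := by
  obtain ⟨a, c, htac, hsub⟩ : ∃ a c, t ∈ Ioo a c ∧ Icc a c ⊆ Ioo 0 b := by
    refine ⟨t / 2, (t + b) / 2, ⟨by linarith [ht.1], by linarith [ht.2]⟩, ?_⟩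
    intro s hs
    exact ⟨by linarith [ht.1, hs.1], by linarith [ht.2, hs.2]⟩
  have hK : IsCompact (Icc a c ×ˢ Icc 0 (2 * Real.pi)) := isCompact_Icc.prod isCompact_Icc
  obtain ⟨C, hC⟩ := hK.exists_bound_of_continuousOn
    (hF'.mono (prod_mono hsub (subset_univ _)))
  have hmem : ∀ {s}, s ∈ Ioo a c → s ∈ Ioo 0 b := fun hs => hsub (Ioo_subset_Icc_self hs)
  refine (intervalIntegral.hasDerivAt_integral_of_dominated_loc_of_deriv_le
    (F := fun s θ => F (s, θ)) (F' := fun s θ => F' (s, θ)) (bound := fun _ => C)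
    (s := Ioo a c) (Ioo_mem_nhds htac.1 htac.2) ?_ ?_ ?_ ?_ ?_ ?_).2
  · filter_upwards [Ioo_mem_nhds htac.1 htac.2] with s hs
    exact (continuous_slice hF (hmem hs)).aestronglyMeasurable
  · exact (continuous_slice hF ht).intervalIntegrable _ _
  · exact (continuous_slice hF' ht).aestronglyMeasurable
  · refine Filter.Eventually.of_forall fun θ hθ s hs => hC (s, θ) ⟨Ioo_subset_Icc_self hs, ?_⟩
    rw [uIoc_of_le Real.two_pi_pos.le] at hθ
    exact Ioc_subset_Icc_self hθ
  · simp
  · exact Filter.Eventually.of_forall fun θ _ s hs => hd s (hmem hs) θ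

/-! ### Fourier coefficients in the angular variable -/

/-- The character `θ ↦ e^{-ikθ}`. -/
def wave (k : ℤ) (θ : ℝ) : ℂ := Complex.exp (-(k * θ * Complex.I))

/-- The `k`-th complex Fourier coefficient `(2π)⁻¹ ∫_0^{2π} e^{-ikθ} g(θ) dθ` of a real function,
written as an integral over one period so that it can be differentiated under the integral sign. -/
def angularCoeff (k : ℤ) (g : ℝ → ℝ) : ℂ :=
  ((1 / (2 * Real.pi) : ℝ) : ℂ) * ∫ θ in (0 : ℝ)..(2 * Real.pi), wave k θ * g θ

theorem continuous_wave (k : ℤ) : Continuous (wave k) := by unfold wave; fun_prop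

theorem hasDerivAt_wave (k : ℤ) (θ : ℝ) :
    HasDerivAt (wave k) (-(k * Complex.I) * wave k θ) θ := by
  have h1 : HasDerivAt (fun z : ℂ => Complex.exp (-(k * z * Complex.I)))
      (Complex.exp (-(k * (θ : ℂ) * Complex.I)) * (-(k * 1 * Complex.I))) (θ : ℂ) :=
    ((((hasDerivAt_id (θ : ℂ)).const_mul (k : ℂ)).mul_const Complex.I).neg).cexp
  refine h1.comp_ofReal.congr_deriv ?_
  rw [wave]; ring

theorem wave_two_pi (k : ℤ) : wave k (2 * Real.pi) = wave k 0 := by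
  unfold wave
  have : -((k : ℂ) * ((2 * Real.pi : ℝ) : ℂ) * Complex.I) =
      ((-k : ℤ) : ℂ) * (2 * Real.pi * Complex.I) := by push_cast; ring
  rw [this, Complex.exp_int_mul_two_pi_mul_I]
  simp

theorem angularCoeff_eq_fourierCoeffOn (k : ℤ) (g : ℝ → ℝ) :
    angularCoeff k g = fourierCoeffOn Real.two_pi_pos (fun θ => (g θ : ℂ)) k := by
  rw [fourierCoeffOn_eq_integral, angularCoeff, Complex.real_smul]
  congr 1
  · simp
  · refine intervalIntegral.integral_congr fun θ _ => ?_
    simp only [smul_eq_mul, wave]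
    congr 1
    rw [fourier_coe_apply]
    congr 1
    have : (Real.pi : ℂ) ≠ 0 := by exact_mod_cast Real.pi_ne_zero
    push_cast
    rw [sub_zero]
    field_simp

theorem hasSum_sq_angularCoeff {g : ℝ → ℝ} (hg : Continuous g) :
    HasSum (fun k => ‖angularCoeff k g‖ ^ 2)
      ((2 * Real.pi)⁻¹ * ∫ θ in (0 : ℝ)..(2 * Real.pi), g θ ^ 2) := by
  have hL2 : MemLp (fun θ => (g θ : ℂ)) 2 (volume.restrict (Ioc 0 (2 * Real.pi))) := by
    have hc : Continuous fun θ => (g θ : ℂ) := Complex.continuous_ofReal.comp hg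
    obtain ⟨C, hC⟩ := (isCompact_Icc (a := (0 : ℝ)) (b := 2 * Real.pi)).exists_bound_of_continuousOn
      hc.continuousOn
    refine MemLp.of_bound hc.aestronglyMeasurable C ?_
    filter_upwards [ae_restrict_mem measurableSet_Ioc] with θ hθ
    exact hC θ (Ioc_subset_Icc_self hθ)
  have := hasSum_sq_fourierCoeffOn Real.two_pi_pos hL2
  simp only [← angularCoeff_eq_fourierCoeffOn, sub_zero, smul_eq_mul, Complex.norm_real,
    Real.norm_eq_abs, sq_abs] at this
  exact this

/-- What is needed of a `C²` function `w` on the open cylinder `(0, b) × S¹`: its first and second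
derivatives `wt`, `wtt` in `t` and `wx`, `wxx` in the angle are continuous. Mixed derivatives do not
enter, and periodicity is recorded only at the ends of one period. -/
structure IsStripJet (b : ℝ) (w wt wtt wx wxx : ℝ × ℝ → ℝ) : Prop where
  cont : ContinuousOn w (Ioo 0 b ×ˢ univ)
  cont_t : ContinuousOn wt (Ioo 0 b ×ˢ univ)
  cont_tt : ContinuousOn wtt (Ioo 0 b ×ˢ univ)
  cont_x : ContinuousOn wx (Ioo 0 b ×ˢ univ)
  cont_xx : ContinuousOn wxx (Ioo 0 b ×ˢ univ)
  deriv_t : ∀ t ∈ Ioo 0 b, ∀ θ, HasDerivAt (fun s => w (s, θ)) (wt (t, θ)) t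
  deriv_tt : ∀ t ∈ Ioo 0 b, ∀ θ, HasDerivAt (fun s => wt (s, θ)) (wtt (t, θ)) t
  deriv_x : ∀ t ∈ Ioo 0 b, ∀ θ, HasDerivAt (fun s => w (t, s)) (wx (t, θ)) θ
  deriv_xx : ∀ t ∈ Ioo 0 b, ∀ θ, HasDerivAt (fun s => wx (t, s)) (wxx (t, θ)) θ
  periodic : ∀ t ∈ Ioo 0 b, w (t, 2 * Real.pi) = w (t, 0)
  periodic_x : ∀ t ∈ Ioo 0 b, wx (t, 2 * Real.pi) = wx (t, 0)

theorem continuousOn_wave_mul (k : ℤ) {s : Set ℝ} {F : ℝ × ℝ → ℝ}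
    (hF : ContinuousOn F (s ×ˢ univ)) :
    ContinuousOn (fun p : ℝ × ℝ => wave k p.2 * (F p : ℂ)) (s ×ˢ univ) :=
  ((continuous_wave k).comp continuous_snd).continuousOn.mul
    (Complex.continuous_ofReal.comp_continuousOn hF)

theorem continuousOn_angularCoeff (k : ℤ) {s : Set ℝ} [LocallyCompactSpace s] {F : ℝ × ℝ → ℝ}
    (hF : ContinuousOn F (s ×ˢ univ)) :
    ContinuousOn (fun t => angularCoeff k fun θ => F (t, θ)) s :=
  continuousOn_const.mul (continuousOn_circleIntegral (continuousOn_wave_mul k hF))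

theorem hasDerivAt_angularCoeff (k : ℤ) {b : ℝ} {F F' : ℝ × ℝ → ℝ}
    (hF : ContinuousOn F (Ioo 0 b ×ˢ univ)) (hF' : ContinuousOn F' (Ioo 0 b ×ˢ univ))
    (hd : ∀ t ∈ Ioo 0 b, ∀ θ, HasDerivAt (fun s => F (s, θ)) (F' (t, θ)) t)
    {t : ℝ} (ht : t ∈ Ioo 0 b) :
    HasDerivAt (fun s => angularCoeff k fun θ => F (s, θ)) (angularCoeff k fun θ => F' (t, θ)) t :=
  (hasDerivAt_circleIntegral (F := fun p => wave k p.2 * (F p : ℂ))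
    (F' := fun p => wave k p.2 * (F' p : ℂ)) (continuousOn_wave_mul k hF)
    (continuousOn_wave_mul k hF') (fun t ht θ => ((hd t ht θ).ofReal_comp).const_mul (wave k θ))
    ht).const_mul _

instance locallyCompactSpace_strip (b : ℝ) : LocallyCompactSpace (Ioo 0 b) :=
  isOpen_Ioo.locallyCompactSpace

theorem angularCoeff_second_deriv (k : ℤ) {g g' g'' : ℝ → ℝ}
    (h1 : ∀ θ, HasDerivAt g (g' θ) θ) (h2 : ∀ θ, HasDerivAt g' (g'' θ) θ) (hc : Continuous g'')
    (hp : g (2 * Real.pi) = g 0) (hp' : g' (2 * Real.pi) = g' 0) :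
    angularCoeff k g'' = -((k : ℂ) ^ 2) * angularCoeff k g := by
  have hg : Continuous g := continuous_iff_continuousAt.2 fun θ => (h1 θ).continuousAt
  have hd : ∀ θ ∈ uIcc (0 : ℝ) (2 * Real.pi), HasDerivAt
      (fun θ => wave k θ * (g' θ : ℂ) + (k * Complex.I) * (wave k θ * (g θ : ℂ)))
      (wave k θ * (g'' θ : ℂ) + (k : ℂ) ^ 2 * (wave k θ * (g θ : ℂ))) θ := by
    intro θ _
    refine (((hasDerivAt_wave k θ).mul (h2 θ).ofReal_comp).add
      (((hasDerivAt_wave k θ).mul (h1 θ).ofReal_comp).const_mul (k * Complex.I))).congr_deriv ?_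
    linear_combination (-((k : ℂ) ^ 2 * wave k θ * g θ)) * Complex.I_mul_I
  have c1 : Continuous fun θ => wave k θ * (g'' θ : ℂ) :=
    (continuous_wave k).mul (Complex.continuous_ofReal.comp hc)
  have c2 : Continuous fun θ => (k : ℂ) ^ 2 * (wave k θ * (g θ : ℂ)) :=
    continuous_const.mul ((continuous_wave k).mul (Complex.continuous_ofReal.comp hg))
  have hI := intervalIntegral.integral_eq_sub_of_hasDerivAt hd
    ((c1.add c2).intervalIntegrable _ _)
  rw [intervalIntegral.integral_add (c1.intervalIntegrable _ _) (c2.intervalIntegrable _ _),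
    intervalIntegral.integral_const_mul, hp, hp', wave_two_pi, sub_self] at hI
  unfold angularCoeff
  linear_combination ((1 / (2 * Real.pi) : ℝ) : ℂ) * hI

theorem angularCoeff_add (k : ℤ) {g₁ g₂ : ℝ → ℝ} (h1 : Continuous g₁) (h2 : Continuous g₂) :
    angularCoeff k (fun θ => g₁ θ + g₂ θ) = angularCoeff k g₁ + angularCoeff k g₂ := by
  unfold angularCoeff
  rw [← mul_add, ← intervalIntegral.integral_add]
  · simp only [Complex.ofReal_add, mul_add]
  · exact ((continuous_wave k).mul (Complex.continuous_ofReal.comp h1)).intervalIntegrable _ _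
  · exact ((continuous_wave k).mul (Complex.continuous_ofReal.comp h2)).intervalIntegrable _ _

/-- The equation for the Fourier coefficients: two integrations by parts in the angle. -/
theorem IsStripJet.isModeSolution {b : ℝ} {w wt wtt wx wxx : ℝ × ℝ → ℝ}
    (h : IsStripJet b w wt wtt wx wxx) (k : ℤ) :
    IsModeSolution b k.natAbs (fun t => angularCoeff k fun θ => w (t, θ))
      (fun t => angularCoeff k fun θ => wt (t, θ))
      (fun t => angularCoeff k fun θ => wtt (t, θ) + wxx (t, θ)) := by
  have hc : ContinuousOn (fun p => wtt p + wxx p) (Ioo 0 b ×ˢ univ) := h.cont_tt.add h.cont_xx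
  have e0 : (((k.natAbs : ℝ) ^ 2 : ℝ) : ℂ) = (k : ℂ) ^ 2 := by
    rw [Nat.cast_natAbs, Int.cast_abs, sq_abs]; push_cast; rfl
  have h1 : ∀ t ∈ Ioo 0 b, HasDerivAt (fun t => angularCoeff k fun θ => w (t, θ))
      (angularCoeff k fun θ => wt (t, θ)) t := fun t ht =>
    hasDerivAt_angularCoeff k h.cont h.cont_t h.deriv_t ht
  have h2 : ∀ t ∈ Ioo 0 b, HasDerivAt (fun t => angularCoeff k fun θ => wt (t, θ))
      (angularCoeff k fun θ => wtt (t, θ)) t := fun t ht =>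
    hasDerivAt_angularCoeff k h.cont_t h.cont_tt h.deriv_tt ht
  have h3 := continuousOn_angularCoeff k hc
  have h4 : ∀ t ∈ Ioo 0 b, angularCoeff k (fun θ => wtt (t, θ)) =
      (k : ℂ) ^ 2 * angularCoeff k (fun θ => w (t, θ)) +
      angularCoeff k (fun θ => wtt (t, θ) + wxx (t, θ)) := fun t ht => by
    have e := angularCoeff_second_deriv k (h.deriv_x t ht) (h.deriv_xx t ht)
      (continuous_slice h.cont_xx ht) (h.periodic t ht) (h.periodic_x t ht)
    rw [angularCoeff_add k (continuous_slice h.cont_tt ht) (continuous_slice h.cont_xx ht), e]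
    ring
  refine ⟨h1, fun t ht => ?_, h3⟩
  rw [e0, ← h4 t ht]
  exact h2 t ht

/-! ### Summation over the Fourier modes -/

theorem sq_intervalIntegral_le {y z : ℝ} (hyz : y ≤ z) {g : ℝ → ℝ}
    (hg : ContinuousOn g (Icc y z)) :
    (∫ s in y..z, g s) ^ 2 ≤ (z - y) * ∫ s in y..z, g s ^ 2 := by
  rcases hyz.eq_or_lt with rfl | hlt
  · simp
  have hg' : ContinuousOn g (uIcc y z) := by rwa [uIcc_of_le hyz]
  have i1 : IntervalIntegrable g volume y z := hg'.intervalIntegrable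
  have i2 : IntervalIntegrable (fun s => g s ^ 2) volume y z := (hg'.pow 2).intervalIntegrable
  set l := z - y with hl
  set I := ∫ s in y..z, g s
  -- the variance of `g`, scaled by the length of the interval
  have h0 : 0 ≤ ∫ s in y..z, (l * g s - I) ^ 2 :=
    intervalIntegral.integral_nonneg hyz fun _ _ => sq_nonneg _
  have h1 : ∫ s in y..z, (l * g s - I) ^ 2 =
      l * (l * (∫ s in y..z, g s ^ 2) - I ^ 2) := by
    have : ∀ s, (l * g s - I) ^ 2 = l ^ 2 * g s ^ 2 - (2 * l * I) * g s + I ^ 2 := fun s => by ring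
    simp only [this]
    rw [intervalIntegral.integral_add ((i2.const_mul _).sub (i1.const_mul _))
      intervalIntegrable_const, intervalIntegral.integral_sub (i2.const_mul _) (i1.const_mul _),
      intervalIntegral.integral_const_mul, intervalIntegral.integral_const_mul,
      intervalIntegral.integral_const, smul_eq_mul]
    ring
  rw [h1] at h0
  have := nonneg_of_mul_nonneg_right h0 (by linarith)
  linarith

theorem sq_weighted_sum_le {A κ a₁ a₂ a₃ σ x y : ℝ} (hA : 0 ≤ A)
    (h : A ≤ κ * (a₁ + a₂ + a₃) + 2 * σ * (x + y)) :
    A ^ 2 ≤ 5 * κ ^ 2 * (a₁ ^ 2 + a₂ ^ 2 + a₃ ^ 2) + 20 * σ ^ 2 * (x ^ 2 + y ^ 2) := by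
  have h1 : A ^ 2 ≤ (κ * (a₁ + a₂ + a₃) + 2 * σ * (x + y)) ^ 2 := pow_le_pow_left₀ hA h 2
  nlinarith [sq_nonneg (κ * a₁ - κ * a₂), sq_nonneg (κ * a₁ - κ * a₃), sq_nonneg (κ * a₂ - κ * a₃),
    sq_nonneg (κ * a₁ - 2 * σ * x), sq_nonneg (κ * a₂ - 2 * σ * x), sq_nonneg (κ * a₃ - 2 * σ * x),
    sq_nonneg (κ * a₁ - 2 * σ * y), sq_nonneg (κ * a₂ - 2 * σ * y), sq_nonneg (κ * a₃ - 2 * σ * y),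
    sq_nonneg (2 * σ * x - 2 * σ * y)]

/-- The weighted energy `e^{-2mt} ∫_0^{2π} w(t, θ)² dθ` of one circle. -/
def sliceEnergy (m : ℕ) (w : ℝ × ℝ → ℝ) (t : ℝ) : ℝ :=
  Real.exp (-(2 * (m : ℝ) * t)) * ∫ θ in (0 : ℝ)..(2 * Real.pi), w (t, θ) ^ 2

theorem sliceEnergy_nonneg (m : ℕ) (w : ℝ × ℝ → ℝ) (t : ℝ) : 0 ≤ sliceEnergy m w t :=
  mul_nonneg (Real.exp_pos _).le
    (intervalIntegral.integral_nonneg Real.two_pi_pos.le fun _ _ => sq_nonneg _)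

theorem continuousOn_sliceEnergy (m : ℕ) {s : Set ℝ} [LocallyCompactSpace s] {w : ℝ × ℝ → ℝ}
    (hw : ContinuousOn w (s ×ˢ univ)) : ContinuousOn (sliceEnergy m w) s := by
  refine ContinuousOn.mul (Continuous.continuousOn (by fun_prop)) ?_
  exact continuousOn_circleIntegral (F := fun p => w p ^ 2) (hw.pow 2)

/-- Parseval's identity on the circle at `t`. -/
theorem hasSum_sliceEnergy (m : ℕ) {w : ℝ × ℝ → ℝ} {t : ℝ} (hw : Continuous fun θ => w (t, θ)) :
    HasSum (fun k => (Real.exp (-(m * t)) * ‖angularCoeff k fun θ => w (t, θ)‖) ^ 2)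
      ((2 * Real.pi)⁻¹ * sliceEnergy m w t) := by
  have h := (hasSum_sq_angularCoeff hw).mul_left (Real.exp (-(2 * (m : ℝ) * t)))
  have e : Real.exp (-(2 * (m : ℝ) * t)) = Real.exp (-(m * t)) ^ 2 := by
    rw [← Real.exp_nat_mul]; congr 1; push_cast; ring
  have e1 : ∀ k, Real.exp (-(2 * (m : ℝ) * t)) * ‖angularCoeff k fun θ => w (t, θ)‖ ^ 2 =
      (Real.exp (-(m * t)) * ‖angularCoeff k fun θ => w (t, θ)‖) ^ 2 := fun k => by rw [e]; ring
  simp only [e1] at h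
  rwa [mul_left_comm] at h

theorem sum_resonant_le {m : ℕ} (hm : 1 ≤ m) (g : ℤ → ℝ) (s : Finset ℤ) :
    ∑ k ∈ s, (if k.natAbs = m then g k else 0) ^ 2 ≤ g m ^ 2 + g (-m) ^ 2 := by
  have e : ∀ k, (if k.natAbs = m then g k else 0) ^ 2 =
      if k.natAbs = m then g k ^ 2 else 0 := fun k => by split_ifs <;> simp
  simp only [e]
  rw [← Finset.sum_filter, ← Finset.sum_pair (f := fun k => g k ^ 2) (by lia : (m : ℤ) ≠ -m)]
  refine Finset.sum_le_sum_of_subset_of_nonneg (fun k hk => ?_) fun _ _ _ => sq_nonneg _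
  rw [Finset.mem_filter] at hk
  rw [Finset.mem_insert, Finset.mem_singleton]
  lia

/-- Cauchy–Schwarz in `t` and Bessel's inequality in the angle, for the coefficients of the
Laplacian. -/
theorem IsStripJet.sum_sq_integral_le {b : ℝ} {w wt wtt wx wxx : ℝ × ℝ → ℝ}
    (h : IsStripJet b w wt wtt wx wxx) {y z : ℝ} (hyz : y ≤ z) (hy : y ∈ Ioo 0 b)
    (hz : z ∈ Ioo 0 b) (s : Finset ℤ) :
    ∑ k ∈ s, (∫ r in y..z, ‖angularCoeff k fun θ => wtt (r, θ) + wxx (r, θ)‖) ^ 2 ≤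
      (z - y) * ((2 * Real.pi)⁻¹ *
        ∫ r in y..z, ∫ θ in (0 : ℝ)..(2 * Real.pi), (wtt (r, θ) + wxx (r, θ)) ^ 2) := by
  have hsub : Icc y z ⊆ Ioo 0 b := fun r hr => ⟨hy.1.trans_le hr.1, hr.2.trans_lt hz.2⟩
  have hc : ContinuousOn (fun p => wtt p + wxx p) (Ioo 0 b ×ˢ univ) := h.cont_tt.add h.cont_xx
  have hck : ∀ k : ℤ, ContinuousOn
      (fun r => ‖angularCoeff k fun θ => wtt (r, θ) + wxx (r, θ)‖) (Icc y z) := fun k =>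
    ((continuousOn_angularCoeff k hc).mono hsub).norm
  have hN : ContinuousOn (fun r => (2 * Real.pi)⁻¹ *
      ∫ θ in (0 : ℝ)..(2 * Real.pi), (wtt (r, θ) + wxx (r, θ)) ^ 2) (Icc y z) :=
    continuousOn_const.mul ((continuousOn_circleIntegral
      (F := fun p => (wtt p + wxx p) ^ 2) (hc.pow 2)).mono hsub)
  have hu := uIcc_of_le hyz
  have hi : ∀ k ∈ s, IntervalIntegrable
      (fun r => ‖angularCoeff k fun θ => wtt (r, θ) + wxx (r, θ)‖ ^ 2) volume y z := fun k _ => by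
    have := (hck k).pow 2
    rw [← hu] at this
    exact this.intervalIntegrable
  calc _ ≤ ∑ k ∈ s, (z - y) *
        ∫ r in y..z, ‖angularCoeff k fun θ => wtt (r, θ) + wxx (r, θ)‖ ^ 2 :=
        Finset.sum_le_sum fun k _ => sq_intervalIntegral_le hyz (hck k)
    _ = (z - y) * ∫ r in y..z,
        ∑ k ∈ s, ‖angularCoeff k fun θ => wtt (r, θ) + wxx (r, θ)‖ ^ 2 := by
        rw [← Finset.mul_sum, intervalIntegral.integral_finsetSum hi]
    _ ≤ _ := by
        rw [← intervalIntegral.integral_const_mul (2 * Real.pi)⁻¹]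
        refine mul_le_mul_of_nonneg_left ?_ (by linarith)
        refine intervalIntegral.integral_mono_on hyz
          (by simpa only [Finset.sum_fn] using IntervalIntegrable.sum _ hi) ?_ ?_
        · rw [← hu] at hN
          exact hN.intervalIntegrable
        · intro r hr
          exact sum_le_hasSum s (fun _ _ => sq_nonneg _)
            (hasSum_sq_angularCoeff (continuous_slice hc (hsub hr)))

/-- The weighted size at `c` of `v' + m v`, where `v` is the `k`-th Fourier coefficient; it is used
for `k = ±m`. -/
def resonantSize (m : ℕ) (w wt : ℝ × ℝ → ℝ) (c : ℝ) (k : ℤ) : ℝ :=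
  Real.exp (-(m * c)) * ‖angularCoeff k (fun θ => wt (c, θ)) +
    m * angularCoeff k (fun θ => w (c, θ))‖

/-- The mode estimates, squared and summed over all modes. -/
theorem IsStripJet.sliceEnergy_le {b : ℝ} {w wt wtt wx wxx : ℝ × ℝ → ℝ}
    (h : IsStripJet b w wt wtt wx wxx) {m : ℕ} (hm : 1 ≤ m) {t σ c : ℝ} (hσ : 1 ≤ σ) {y z : ℝ}
    (hy : y ∈ Ioo 0 b) (hz : z ∈ Ioo 0 b) (h1 : y ≤ t - σ) (h2 : t + σ ≤ z) (hc : c ∈ Icc y z) :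
    sliceEnergy m w t ≤ 5 * (2 * Real.exp m * σ * Real.exp (-σ)) ^ 2 *
        (sliceEnergy m w (t - σ) + sliceEnergy m w (t - σ + 1) + sliceEnergy m w (t + σ)) +
      20 * σ ^ 2 * ((z - y) *
        (∫ r in y..z, ∫ θ in (0 : ℝ)..(2 * Real.pi), (wtt (r, θ) + wxx (r, θ)) ^ 2) +
        2 * Real.pi * (resonantSize m w wt c m ^ 2 + resonantSize m w wt c (-m) ^ 2)) := by
  have hmem : ∀ s ∈ Icc y z, s ∈ Ioo 0 b := fun r hr => ⟨hy.1.trans_le hr.1, hr.2.trans_lt hz.2⟩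
  have hs : ∀ r ∈ Icc y z, HasSum
      (fun k => (Real.exp (-(m * r)) * ‖angularCoeff k fun θ => w (r, θ)‖) ^ 2)
      ((2 * Real.pi)⁻¹ * sliceEnergy m w r) := fun r hr =>
    hasSum_sliceEnergy m (continuous_slice h.cont (hmem r hr))
  have H₀ := hs t ⟨by linarith, by linarith⟩
  have H₁ := hs (t - σ) ⟨by linarith, by linarith⟩
  have H₂ := hs (t - σ + 1) ⟨by linarith, by linarith⟩
  have H₃ := hs (t + σ) ⟨by linarith, by linarith⟩
  have key := hasSum_le_of_sum_le H₀ (fun s => ?_)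
    (c := 5 * (2 * Real.exp m * σ * Real.exp (-σ)) ^ 2 *
      ((2 * Real.pi)⁻¹ * sliceEnergy m w (t - σ) + (2 * Real.pi)⁻¹ * sliceEnergy m w (t - σ + 1) +
        (2 * Real.pi)⁻¹ * sliceEnergy m w (t + σ)) +
      20 * σ ^ 2 * ((z - y) * ((2 * Real.pi)⁻¹ *
        ∫ r in y..z, ∫ θ in (0 : ℝ)..(2 * Real.pi), (wtt (r, θ) + wxx (r, θ)) ^ 2) +
        (resonantSize m w wt c m ^ 2 + resonantSize m w wt c (-m) ^ 2)))
  · have hp := Real.two_pi_pos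
    have := mul_le_mul_of_nonneg_left key hp.le
    field_simp at this ⊢
    linarith
  · calc _ ≤ ∑ k ∈ s, _ := Finset.sum_le_sum fun k _ => sq_weighted_sum_le (by positivity)
          ((h.isModeSolution k).weighted_norm_le hm hσ hy hz h1 h2 hc)
      _ = 5 * (2 * Real.exp m * σ * Real.exp (-σ)) ^ 2 *
          (∑ k ∈ s, (Real.exp (-(m * (t - σ))) * ‖angularCoeff k fun θ => w (t - σ, θ)‖) ^ 2 +
          ∑ k ∈ s, (Real.exp (-(m * (t - σ + 1))) *
            ‖angularCoeff k fun θ => w (t - σ + 1, θ)‖) ^ 2 +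
          ∑ k ∈ s, (Real.exp (-(m * (t + σ))) * ‖angularCoeff k fun θ => w (t + σ, θ)‖) ^ 2) +
          20 * σ ^ 2 *
          (∑ k ∈ s, (∫ r in y..z, ‖angularCoeff k fun θ => wtt (r, θ) + wxx (r, θ)‖) ^ 2 +
          ∑ k ∈ s, (if k.natAbs = m then resonantSize m w wt c k else 0) ^ 2) := by
          rw [Finset.sum_add_distrib, ← Finset.mul_sum, ← Finset.mul_sum,
            Finset.sum_add_distrib, Finset.sum_add_distrib, Finset.sum_add_distrib]
          rfl
      _ ≤ _ := by
          gcongr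
          · exact sum_le_hasSum s (fun _ _ => sq_nonneg _) H₁
          · exact sum_le_hasSum s (fun _ _ => sq_nonneg _) H₂
          · exact sum_le_hasSum s (fun _ _ => sq_nonneg _) H₃
          · exact h.sum_sq_integral_le (by linarith) hy hz s
          · exact sum_resonant_le hm _ s

theorem integral_shift_le {b : ℝ} {N : ℝ → ℝ} (hN : ContinuousOn N (Icc 0 b)) (h0 : ∀ t, 0 ≤ N t)
    {x y d : ℝ} (hxy : x ≤ y) (hx : 0 ≤ x + d) (hy : y + d ≤ b) :
    IntervalIntegrable (fun t => N (t + d)) volume x y ∧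
      ∫ t in x..y, N (t + d) ≤ ∫ t in (0 : ℝ)..b, N t := by
  have hb : 0 ≤ b := by linarith
  constructor
  · refine ContinuousOn.intervalIntegrable ?_
    refine hN.comp (by fun_prop) fun t ht => ?_
    rw [uIcc_of_le hxy] at ht
    exact ⟨by linarith [ht.1], by linarith [ht.2]⟩
  · rw [intervalIntegral.integral_comp_add_right]
    refine intervalIntegral.integral_mono_interval hx (by linarith) hy
      (Filter.Eventually.of_forall h0) ?_
    rw [← uIcc_of_le hb] at hN
    exact hN.intervalIntegrable

/-- The slice estimate with shift `L - 1`, integrated over the middle piece. The shift is shorter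
than `L` so that only points of `[1, 3L - 1]`, away from the boundary, are involved. -/
theorem IsStripJet.integral_sliceEnergy_le {L : ℝ} (hL : 2 ≤ L) {w wt wtt wx wxx : ℝ × ℝ → ℝ}
    (h : IsStripJet (3 * L) w wt wtt wx wxx) (hw : ContinuousOn w (Icc 0 (3 * L) ×ˢ univ))
    {m : ℕ} (hm : 1 ≤ m) {c : ℝ} (hc : c ∈ Icc 1 (3 * L - 1)) :
    ∫ t in L..(2 * L), sliceEnergy m w t ≤
      15 * (2 * Real.exp m * (L - 1) * Real.exp (-(L - 1))) ^ 2 *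
        (∫ t in (0 : ℝ)..(3 * L), sliceEnergy m w t) +
      20 * L ^ 3 * (3 * L *
        (∫ r in (1 : ℝ)..(3 * L - 1), ∫ θ in (0 : ℝ)..(2 * Real.pi),
          (wtt (r, θ) + wxx (r, θ)) ^ 2) +
        2 * Real.pi * (resonantSize m w wt c m ^ 2 + resonantSize m w wt c (-m) ^ 2)) := by
  have : LocallyCompactSpace (Icc 0 (3 * L)) := inferInstance
  have hN : ContinuousOn (sliceEnergy m w) (Icc 0 (3 * L)) := continuousOn_sliceEnergy m hw
  have hN0 := sliceEnergy_nonneg m w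
  set B := ∫ r in (1 : ℝ)..(3 * L - 1), ∫ θ in (0 : ℝ)..(2 * Real.pi),
          (wtt (r, θ) + wxx (r, θ)) ^ 2
  have hB : 0 ≤ B := intervalIntegral.integral_nonneg (by linarith) fun _ _ =>
    intervalIntegral.integral_nonneg Real.two_pi_pos.le fun _ _ => sq_nonneg _
  set G := 2 * Real.pi * (resonantSize m w wt c m ^ 2 + resonantSize m w wt c (-m) ^ 2)
  have hG : 0 ≤ G := by have := Real.pi_pos; positivity
  set κ := 2 * Real.exp m * (L - 1) * Real.exp (-(L - 1))
  obtain ⟨i₀, -⟩ := integral_shift_le hN hN0 (x := L) (y := 2 * L) (d := 0) (by linarith)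
    (by linarith) (by linarith)
  obtain ⟨i₁, b₁⟩ := integral_shift_le hN hN0 (x := L) (y := 2 * L) (d := -(L - 1)) (by linarith)
    (by linarith) (by linarith)
  obtain ⟨i₂, b₂⟩ := integral_shift_le hN hN0 (x := L) (y := 2 * L) (d := -(L - 1) + 1)
    (by linarith) (by linarith) (by linarith)
  obtain ⟨i₃, b₃⟩ := integral_shift_le hN hN0 (x := L) (y := 2 * L) (d := L - 1)
    (by linarith) (by linarith) (by linarith)
  simp only [add_zero] at i₀
  set E := ∫ t in (0 : ℝ)..(3 * L), sliceEnergy m w t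
  have hpt : ∀ t ∈ Icc L (2 * L), sliceEnergy m w t ≤ 5 * κ ^ 2 *
      (sliceEnergy m w (t + -(L - 1)) + sliceEnergy m w (t + (-(L - 1) + 1)) +
        sliceEnergy m w (t + (L - 1))) + 20 * L ^ 2 * (3 * L * B + G) := by
    intro t ht
    have := h.sliceEnergy_le hm (t := t) (σ := L - 1) (by linarith) (y := 1) (z := 3 * L - 1)
      ⟨by linarith, by linarith⟩ ⟨by linarith, by linarith⟩ (by linarith [ht.1])
      (by linarith [ht.2]) hc
    rw [← add_assoc, ← sub_eq_add_neg]
    refine this.trans (add_le_add_right ?_ _)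
    have e1 : (L - 1) ^ 2 ≤ L ^ 2 := pow_le_pow_left₀ (by linarith) (by linarith) 2
    have e2 : (3 * L - 1 - 1) * B ≤ 3 * L * B := by gcongr; linarith
    refine mul_le_mul (by linarith) (by linarith) (add_nonneg (mul_nonneg (by linarith) hB) hG)
      (by positivity)
  have hmono := intervalIntegral.integral_mono_on (by linarith : L ≤ 2 * L) i₀
    ((((i₁.add i₂).add i₃).const_mul (5 * κ ^ 2)).add
      (intervalIntegrable_const (c := 20 * L ^ 2 * (3 * L * B + G)))) hpt
  rw [intervalIntegral.integral_add (((i₁.add i₂).add i₃).const_mul (5 * κ ^ 2))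
      intervalIntegrable_const, intervalIntegral.integral_const_mul,
      intervalIntegral.integral_add (i₁.add i₂) i₃, intervalIntegral.integral_add i₁ i₂,
      intervalIntegral.integral_const, smul_eq_mul] at hmono
  have : 5 * κ ^ 2 * ((∫ t in L..(2 * L), sliceEnergy m w (t + -(L - 1))) +
      (∫ t in L..(2 * L), sliceEnergy m w (t + (-(L - 1) + 1))) +
      (∫ t in L..(2 * L), sliceEnergy m w (t + (L - 1)))) ≤ 5 * κ ^ 2 * (E + E + E) := by
    gcongr
  linarith

/-! ### The Caccioppoli inequality -/

theorem setIntegral_rectangle {α β : ℝ} (hαβ : α ≤ β) {F : ℝ × ℝ → ℝ}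
    (hF : ContinuousOn F (Icc α β ×ˢ Icc 0 (2 * Real.pi))) :
    ∫ p in Icc α β ×ˢ Icc 0 (2 * Real.pi), F p =
      ∫ t in α..β, ∫ θ in (0 : ℝ)..(2 * Real.pi), F (t, θ) := by
  rw [Measure.volume_eq_prod, setIntegral_prod F
    (hF.integrableOn_compact (isCompact_Icc.prod isCompact_Icc)),
    intervalIntegral.integral_of_le hαβ, integral_Icc_eq_integral_Ioc]
  refine integral_congr_ae (Filter.Eventually.of_forall fun t => ?_)
  simp only
  rw [intervalIntegral.integral_of_le Real.two_pi_pos.le, integral_Icc_eq_integral_Ioc]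

theorem setIntegral_eq_zero_of_deriv_fst {α β : ℝ} (hαβ : α ≤ β) {F G : ℝ × ℝ → ℝ}
    (hF : ContinuousOn F (Icc α β ×ˢ Icc 0 (2 * Real.pi)))
    (hd : ∀ t ∈ Icc α β, ∀ θ, HasDerivAt (fun s => G (s, θ)) (F (t, θ)) t)
    (hG : ∀ θ, G (α, θ) = G (β, θ)) :
    ∫ p in Icc α β ×ˢ Icc 0 (2 * Real.pi), F p = 0 := by
  have hint := hF.integrableOn_compact (μ := volume) (isCompact_Icc.prod isCompact_Icc)
  rw [setIntegral_rectangle hαβ hF, intervalIntegral_intervalIntegral_swap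
    (F := fun t θ => F (t, θ))]
  · refine (intervalIntegral.integral_congr fun θ hθ => ?_).trans
      (intervalIntegral.integral_zero (a := (0 : ℝ)) (b := 2 * Real.pi))
    rw [uIcc_of_le Real.two_pi_pos.le] at hθ
    rw [intervalIntegral.integral_eq_sub_of_hasDerivAt (f := fun s => G (s, θ)), hG, sub_self]
    · intro t ht
      rw [uIcc_of_le hαβ] at ht
      exact hd t ht θ
    · refine ContinuousOn.intervalIntegrable ?_
      refine hF.comp (by fun_prop) fun t ht => ?_
      rw [uIcc_of_le hαβ] at ht
      exact ⟨ht, hθ⟩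
  · refine hint.mono_set (prod_mono ?_ ?_)
    · rw [uIoc_of_le hαβ]; exact Ioc_subset_Icc_self
    · rw [uIoc_of_le Real.two_pi_pos.le]; exact Ioc_subset_Icc_self

theorem setIntegral_eq_zero_of_deriv_snd {α β : ℝ} (hαβ : α ≤ β) {F G : ℝ × ℝ → ℝ}
    (hF : ContinuousOn F (Icc α β ×ˢ Icc 0 (2 * Real.pi)))
    (hd : ∀ t ∈ Icc α β, ∀ θ, HasDerivAt (fun s => G (t, s)) (F (t, θ)) θ)
    (hG : ∀ t ∈ Icc α β, G (t, 0) = G (t, 2 * Real.pi)) :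
    ∫ p in Icc α β ×ˢ Icc 0 (2 * Real.pi), F p = 0 := by
  rw [setIntegral_rectangle hαβ hF]
  refine (intervalIntegral.integral_congr fun t ht => ?_).trans
    (intervalIntegral.integral_zero (a := α) (b := β))
  rw [uIcc_of_le hαβ] at ht
  rw [intervalIntegral.integral_eq_sub_of_hasDerivAt (f := fun s => G (t, s)), hG t ht, sub_self]
  · exact fun θ _ => hd t ht θ
  · refine ContinuousOn.intervalIntegrable ?_
    refine hF.comp (by fun_prop) fun θ hθ => ?_
    rw [uIcc_of_le Real.two_pi_pos.le] at hθ
    exact ⟨ht, hθ⟩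

/-- Integration by parts of `ψ Δ(w²) / 2` against a cut-off `ψ` in `t` that vanishes at the ends
together with its derivative. -/
theorem IsStripJet.integral_cutoff_eq_zero {b : ℝ} {w wt wtt wx wxx : ℝ × ℝ → ℝ}
    (h : IsStripJet b w wt wtt wx wxx) {α β : ℝ} (hα : 0 < α) (hαβ : α ≤ β) (hβ : β < b)
    {ψ ψ₁ ψ₂ : ℝ → ℝ} (h1 : ∀ t, HasDerivAt ψ (ψ₁ t) t) (h2 : ∀ t, HasDerivAt ψ₁ (ψ₂ t) t)
    (hψ₂ : Continuous ψ₂) (ha : ψ α = 0) (hb : ψ β = 0) (ha' : ψ₁ α = 0) (hb' : ψ₁ β = 0) :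
    ∫ p in Icc α β ×ˢ Icc 0 (2 * Real.pi), (ψ p.1 * (wt p ^ 2 + wx p ^ 2 +
      w p * (wtt p + wxx p)) - 1 / 2 * ψ₂ p.1 * w p ^ 2) = 0 := by
  have hsub : Icc α β ⊆ Ioo 0 b := fun t ht => ⟨hα.trans_le ht.1, ht.2.trans_lt hβ⟩
  have hR : Icc α β ×ˢ Icc 0 (2 * Real.pi) ⊆ Ioo 0 b ×ˢ univ := prod_mono hsub (subset_univ _)
  have hψ : Continuous ψ := continuous_iff_continuousAt.2 fun t => (h1 t).continuousAt
  have c := h.cont.mono hR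
  have ct := h.cont_t.mono hR
  have ctt := h.cont_tt.mono hR
  have cx := h.cont_x.mono hR
  have cxx := h.cont_xx.mono hR
  have cψ : ContinuousOn (fun p : ℝ × ℝ => ψ p.1) (Icc α β ×ˢ Icc 0 (2 * Real.pi)) :=
    (hψ.comp continuous_fst).continuousOn
  have cψ₂ : ContinuousOn (fun p : ℝ × ℝ => ψ₂ p.1) (Icc α β ×ˢ Icc 0 (2 * Real.pi)) :=
    (hψ₂.comp continuous_fst).continuousOn
  have hF₁ : ContinuousOn (fun p => ψ p.1 * (wt p ^ 2 + w p * wtt p) - 1 / 2 * ψ₂ p.1 * w p ^ 2)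
      (Icc α β ×ˢ Icc 0 (2 * Real.pi)) :=
    (cψ.mul ((ct.pow 2).add (c.mul ctt))).sub ((continuousOn_const.mul cψ₂).mul (c.pow 2))
  have hF₂ : ContinuousOn (fun p => ψ p.1 * (wx p ^ 2 + w p * wxx p))
      (Icc α β ×ˢ Icc 0 (2 * Real.pi)) :=
    cψ.mul ((cx.pow 2).add (c.mul cxx))
  have I₁ := setIntegral_eq_zero_of_deriv_fst hαβ hF₁
    (G := fun p => ψ p.1 * (w p * wt p) - 1 / 2 * (ψ₁ p.1 * w p ^ 2))
    (fun t ht θ => by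
      have dw := h.deriv_t t (hsub ht) θ
      have dwt := h.deriv_tt t (hsub ht) θ
      refine (((h1 t).mul (dw.mul dwt)).sub
        (((h2 t).mul (dw.pow 2)).const_mul (1 / 2))).congr_deriv ?_
      simp only [Pi.mul_apply, Pi.pow_apply]
      push_cast
      ring)
    (fun θ => by simp [ha, hb, ha', hb'])
  have I₂ := setIntegral_eq_zero_of_deriv_snd hαβ hF₂
    (G := fun p => ψ p.1 * (w p * wx p))
    (fun t ht θ => by
      refine (((h.deriv_x t (hsub ht) θ).mul (h.deriv_xx t (hsub ht) θ)).const_mul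
        (ψ t)).congr_deriv ?_
      simp only
      ring)
    (fun t ht => by simp only [h.periodic t (hsub ht), h.periodic_x t (hsub ht)])
  have hK := isCompact_Icc (a := α) (b := β) |>.prod (isCompact_Icc (a := 0) (b := 2 * Real.pi))
  have I := integral_add (hF₁.integrableOn_compact (μ := volume) hK)
    (hF₂.integrableOn_compact (μ := volume) hK)
  rw [I₁, I₂, add_zero] at I
  refine (integral_congr_ae (Filter.Eventually.of_forall fun p => ?_)).trans I
  ring

variable {n : ℕ}

/-- Every component of `u` has continuous pure derivatives of order at most `2` on the open cylinder
`(0, b) × S¹`, given by the components of the partial derivatives of `u`. -/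
def HasStripJets (b : ℝ) (u : ℝ × ℝ → Target n) : Prop :=
  ∀ j, IsStripJet b (fun p => u p j) (fun p => partialT u p j)
    (fun p => partialT (partialT u) p j) (fun p => partialTheta u p j)
    (fun p => partialTheta (partialTheta u) p j)

theorem continuousOn_norm_sq {s : Set (ℝ × ℝ)} {f : ℝ × ℝ → Target n}
    (hf : ∀ j, ContinuousOn (fun p => f p j) s) : ContinuousOn (fun p => ‖f p‖ ^ 2) s := by
  simp only [EuclideanSpace.real_norm_sq_eq]
  exact continuousOn_finsetSum _ fun j _ => (hf j).pow 2

theorem gradNorm_sq (u : ℝ × ℝ → Target n) (p : ℝ × ℝ) :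
    gradNorm u p ^ 2 = ‖partialT u p‖ ^ 2 + ‖partialTheta u p‖ ^ 2 := by
  rw [gradNorm, Real.sq_sqrt (by positivity)]

theorem gradNorm_nonneg (u : ℝ × ℝ → Target n) (p : ℝ × ℝ) : 0 ≤ gradNorm u p :=
  Real.sqrt_nonneg _

/-- **Caccioppoli inequality** for solutions of `|Δu| ≤ (|u| + |∇u|) / 2`. -/
theorem HasStripJets.integral_gradNorm_sq_le {b : ℝ} (hb : 2 ≤ b) {u : ℝ × ℝ → Target n}
    (h : HasStripJets b u) {δ : ℝ} (hδ : δ ≤ 1 / 2)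
    (hΔ : ∀ᵐ p ∂volume.restrict (Icc (1 / 2) (b - 1 / 2) ×ˢ Icc 0 (2 * Real.pi)),
      ‖laplace u p‖ ≤ δ * (‖u p‖ + gradNorm u p)) :
    ∫ p in Icc 1 (b - 1) ×ˢ Icc 0 (2 * Real.pi), gradNorm u p ^ 2 ≤
      32 * (b ^ 4 + 2 * b ^ 2) *
        ∫ p in Icc (1 / 2) (b - 1 / 2) ×ˢ Icc 0 (2 * Real.pi), ‖u p‖ ^ 2 := by
  set R := Icc (1 / 2) (b - 1 / 2) ×ˢ Icc 0 (2 * Real.pi) with hRdef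
  have hRm : MeasurableSet R := measurableSet_Icc.prod measurableSet_Icc
  have hsubI : Icc (1 / 2) (b - 1 / 2) ⊆ Ioo 0 b := fun t ht =>
    ⟨by linarith [ht.1], by linarith [ht.2]⟩
  have hR : R ⊆ Ioo 0 b ×ˢ univ := prod_mono hsubI (subset_univ _)
  have hK : IsCompact R := isCompact_Icc.prod isCompact_Icc
  set ψ : ℝ → ℝ := fun t => ((t - 1 / 2) * (b - 1 / 2 - t)) ^ 2 with hψ
  set ψ₁ : ℝ → ℝ := fun t => 2 * ((t - 1 / 2) * (b - 1 / 2 - t)) * (b - 2 * t) with hψ₁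
  set ψ₂ : ℝ → ℝ := fun t => 2 * (b - 2 * t) ^ 2 - 4 * ((t - 1 / 2) * (b - 1 / 2 - t)) with hψ₂
  have hp : ∀ t, HasDerivAt (fun t => (t - 1 / 2) * (b - 1 / 2 - t)) (b - 2 * t) t := fun t => by
    refine (((hasDerivAt_id' t).sub_const (1 / 2)).mul
      ((hasDerivAt_id' t).const_sub (b - 1 / 2))).congr_deriv ?_
    ring
  have d1 : ∀ t, HasDerivAt ψ (ψ₁ t) t := fun t => by
    refine ((hp t).pow 2).congr_deriv ?_
    simp only [hψ₁]; push_cast; ring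
  have d2 : ∀ t, HasDerivAt ψ₁ (ψ₂ t) t := fun t => by
    refine (((hp t).const_mul 2).mul
      (((hasDerivAt_id' t).const_mul 2).const_sub b)).congr_deriv ?_
    simp only [hψ₂]; ring
  have cu : ContinuousOn (fun p => ‖u p‖ ^ 2) R :=
    continuousOn_norm_sq fun j => (h j).cont.mono hR
  have cg : ContinuousOn (fun p => gradNorm u p ^ 2) R := by
    simp only [gradNorm_sq]
    exact (continuousOn_norm_sq fun j => (h j).cont_t.mono hR).add
      (continuousOn_norm_sq fun j => (h j).cont_x.mono hR)
  have cψ : ContinuousOn (fun p : ℝ × ℝ => ψ p.1) R :=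
    Continuous.continuousOn (by simp only [hψ]; fun_prop)
  have cψ₂ : ContinuousOn (fun p : ℝ × ℝ => ψ₂ p.1) R :=
    Continuous.continuousOn (by simp only [hψ₂]; fun_prop)
  -- the cut-off identity, summed over the components
  have key : ∫ p in R, (ψ p.1 * (gradNorm u p ^ 2 + inner ℝ (u p) (laplace u p)) -
      1 / 2 * ψ₂ p.1 * ‖u p‖ ^ 2) = 0 := by
    have hj : ∀ j, ∫ p in R, (ψ p.1 * (partialT u p j ^ 2 + partialTheta u p j ^ 2 +
        u p j * (partialT (partialT u) p j + partialTheta (partialTheta u) p j)) -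
        1 / 2 * ψ₂ p.1 * u p j ^ 2) = 0 := fun j =>
      (h j).integral_cutoff_eq_zero (by norm_num) (by linarith) (by linarith) d1 d2
        (by simp only [hψ₂]; fun_prop) (by simp [hψ]) (by simp [hψ]) (by simp [hψ₁])
        (by simp [hψ₁])
    have hs := Finset.sum_eq_zero fun j (_ : j ∈ Finset.univ) => hj j
    rw [← integral_finsetSum] at hs
    · rw [← hs]
      refine integral_congr_ae (Filter.Eventually.of_forall fun p => ?_)
      simp only [gradNorm_sq, EuclideanSpace.real_norm_sq_eq, PiLp.inner_apply, laplace,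
        PiLp.add_apply, RCLike.inner_apply, conj_trivial]
      rw [Finset.sum_sub_distrib, ← Finset.mul_sum, ← Finset.mul_sum, Finset.sum_add_distrib,
        Finset.sum_add_distrib]
      congr 3
      exact Finset.sum_congr rfl fun j _ => mul_comm _ _
    · intro j _
      have c := (h j).cont.mono hR
      exact ((cψ.mul ((((h j).cont_t.mono hR).pow 2).add (((h j).cont_x.mono hR).pow 2) |>.add
        (c.mul (((h j).cont_tt.mono hR).add ((h j).cont_xx.mono hR))))).sub
        ((continuousOn_const.mul cψ₂).mul (c.pow 2))).integrableOn_compact hK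
  have cl : ∀ j, ContinuousOn (fun p => laplace u p j) R := fun j =>
    ((h j).cont_tt.mono hR).add ((h j).cont_xx.mono hR)
  have ci : ContinuousOn (fun p => inner ℝ (u p) (laplace u p)) R := by
    simp only [PiLp.inner_apply, RCLike.inner_apply, conj_trivial]
    exact continuousOn_finsetSum _ fun j _ => (cl j).mul ((h j).cont.mono hR)
  have iψg : IntegrableOn (fun p => ψ p.1 * gradNorm u p ^ 2) R :=
    (cψ.mul cg).integrableOn_compact hK
  have iu : IntegrableOn (fun p => ‖u p‖ ^ 2) R := cu.integrableOn_compact hK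
  -- the term `u · Δu` costs at most `|u|² + |∇u|² / 2`, and `ψ ≤ b⁴`, `ψ₂ ≤ 4 b²`
  have hlow : ∫ p in R, (1 / 2 * (ψ p.1 * gradNorm u p ^ 2) - (b ^ 4 + 2 * b ^ 2) * ‖u p‖ ^ 2) ≤
      0 := by
    rw [← key]
    refine integral_mono_ae ((iψg.const_mul _).sub (iu.const_mul _))
      (((cψ.mul (cg.add ci)).sub ((continuousOn_const.mul cψ₂).mul cu)).integrableOn_compact hK) ?_
    filter_upwards [hΔ, ae_restrict_mem hRm] with p hpΔ hpR
    obtain ⟨⟨ht1, ht2⟩, -⟩ := hpR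
    have hin : -(‖u p‖ * ‖laplace u p‖) ≤ inner ℝ (u p) (laplace u p) :=
      neg_le_of_abs_le (abs_real_inner_le_norm _ _)
    have hg := gradNorm_nonneg u p
    have hN := norm_nonneg (u p)
    have h3 : ‖u p‖ * ‖laplace u p‖ ≤ ‖u p‖ * (1 / 2 * (‖u p‖ + gradNorm u p)) :=
      mul_le_mul_of_nonneg_left (hpΔ.trans (by gcongr)) hN
    have h4 : -(‖u p‖ ^ 2) - 1 / 2 * gradNorm u p ^ 2 ≤ inner ℝ (u p) (laplace u p) := by
      nlinarith [sq_nonneg (‖u p‖ - gradNorm u p)]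
    have hpoly0 : 0 ≤ (p.1 - 1 / 2) * (b - 1 / 2 - p.1) :=
      mul_nonneg (by linarith) (by linarith)
    have hpoly : (p.1 - 1 / 2) * (b - 1 / 2 - p.1) ≤ b ^ 2 := by
      rw [sq]; exact mul_le_mul (by linarith) (by linarith) (by linarith) (by linarith)
    have hψ0 : 0 ≤ ψ p.1 := sq_nonneg _
    have hψb : ψ p.1 ≤ b ^ 4 := by
      have := pow_le_pow_left₀ hpoly0 hpoly 2
      calc ψ p.1 ≤ (b ^ 2) ^ 2 := this
        _ = b ^ 4 := by ring
    have hψ₂b : ψ₂ p.1 ≤ 4 * b ^ 2 := by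
      have : (b - 2 * p.1) ^ 2 ≤ b ^ 2 := by
        rw [sq_le_sq, abs_of_nonneg (by linarith : (0 : ℝ) ≤ b), abs_le]
        constructor <;> linarith
      simp only [hψ₂]; linarith
    have h5 := mul_le_mul_of_nonneg_left h4 hψ0
    have h6 := mul_le_mul_of_nonneg_right hψb (sq_nonneg ‖u p‖)
    have h7 := mul_le_mul_of_nonneg_right hψ₂b (sq_nonneg ‖u p‖)
    linarith
  rw [integral_sub (iψg.const_mul _) (iu.const_mul _), integral_const_mul, integral_const_mul]
    at hlow
  have hsub : Icc 1 (b - 1) ×ˢ Icc 0 (2 * Real.pi) ⊆ R :=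
    prod_mono (Icc_subset_Icc (by norm_num) (by linarith)) le_rfl
  -- on `[1, b - 1]` both factors of the root of `ψ` are at least `1 / 2`
  have h16 : ∫ p in Icc 1 (b - 1) ×ˢ Icc 0 (2 * Real.pi), gradNorm u p ^ 2 ≤
      ∫ p in R, 16 * (ψ p.1 * gradNorm u p ^ 2) := by
    calc _ ≤ ∫ p in Icc 1 (b - 1) ×ˢ Icc 0 (2 * Real.pi), 16 * (ψ p.1 * gradNorm u p ^ 2) := by
          refine setIntegral_mono_on ((cg.integrableOn_compact hK).mono_set hsub)
            ((iψg.mono_set hsub).const_mul 16) (measurableSet_Icc.prod measurableSet_Icc) ?_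
          rintro p ⟨⟨ht1, ht2⟩, -⟩
          have h1 : 1 / 4 ≤ (p.1 - 1 / 2) * (b - 1 / 2 - p.1) := by nlinarith
          have h2 : 1 / 16 ≤ ψ p.1 := by
            have := pow_le_pow_left₀ (by norm_num) h1 2
            norm_num at this ⊢
            exact this
          nlinarith [sq_nonneg (gradNorm u p)]
      _ ≤ _ := setIntegral_mono_set (iψg.const_mul 16)
          (Filter.Eventually.of_forall fun p => by
            have : 0 ≤ ψ p.1 := sq_nonneg _
            simp only [Pi.zero_apply]; positivity) hsub.eventuallyLE
  rw [integral_const_mul] at h16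
  linarith

theorem HasStripJets.integral_laplace_sq_le {b : ℝ} (hb : 2 ≤ b) {u : ℝ × ℝ → Target n}
    (h : HasStripJets b u) {δ : ℝ} (hδ : δ ≤ 1 / 2)
    (hΔ : ∀ᵐ p ∂volume.restrict (Icc (1 / 2) (b - 1 / 2) ×ˢ Icc 0 (2 * Real.pi)),
      ‖laplace u p‖ ≤ δ * (‖u p‖ + gradNorm u p)) :
    ∫ p in Icc 1 (b - 1) ×ˢ Icc 0 (2 * Real.pi), ‖laplace u p‖ ^ 2 ≤
      2 * δ ^ 2 * (1 + 32 * (b ^ 4 + 2 * b ^ 2)) *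
        ∫ p in Icc (1 / 2) (b - 1 / 2) ×ˢ Icc 0 (2 * Real.pi), ‖u p‖ ^ 2 := by
  have hgrad := h.integral_gradNorm_sq_le hb hδ hΔ
  set R := Icc (1 / 2) (b - 1 / 2) ×ˢ Icc 0 (2 * Real.pi) with hRdef
  set R₁ := Icc 1 (b - 1) ×ˢ Icc 0 (2 * Real.pi) with hR₁def
  have hR : R ⊆ Ioo 0 b ×ˢ univ := prod_mono
    (fun t ht => ⟨by linarith [ht.1], by linarith [ht.2]⟩) (subset_univ _)
  have hsub : R₁ ⊆ R := prod_mono (Icc_subset_Icc (by norm_num) (by linarith)) le_rfl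
  have hK : IsCompact R := isCompact_Icc.prod isCompact_Icc
  have iu : IntegrableOn (fun p => ‖u p‖ ^ 2) R :=
    (continuousOn_norm_sq fun j => (h j).cont.mono hR).integrableOn_compact hK
  have ig : IntegrableOn (fun p => gradNorm u p ^ 2) R := by
    refine ContinuousOn.integrableOn_compact hK ?_
    simp only [gradNorm_sq]
    exact (continuousOn_norm_sq fun j => (h j).cont_t.mono hR).add
      (continuousOn_norm_sq fun j => (h j).cont_x.mono hR)
  have il : IntegrableOn (fun p => ‖laplace u p‖ ^ 2) R :=
    (continuousOn_norm_sq fun j =>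
      ((h j).cont_tt.mono hR).add ((h j).cont_xx.mono hR)).integrableOn_compact hK
  have hle : ∫ p in R₁, ‖laplace u p‖ ^ 2 ≤
      ∫ p in R₁, 2 * δ ^ 2 * (‖u p‖ ^ 2 + gradNorm u p ^ 2) := by
    refine integral_mono_ae (il.mono_set hsub)
      (((iu.mono_set hsub).add (ig.mono_set hsub)).const_mul _) ?_
    filter_upwards [ae_restrict_of_ae_restrict_of_subset hsub hΔ] with p hp
    have := pow_le_pow_left₀ (norm_nonneg _) hp 2
    nlinarith [mul_nonneg (sq_nonneg δ) (sq_nonneg (‖u p‖ - gradNorm u p))]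
  rw [integral_const_mul, integral_add (iu.mono_set hsub) (ig.mono_set hsub)] at hle
  have hu1 : ∫ p in R₁, ‖u p‖ ^ 2 ≤ ∫ p in R, ‖u p‖ ^ 2 :=
    setIntegral_mono_set iu (Filter.Eventually.of_forall fun p => sq_nonneg _) hsub.eventuallyLE
  calc _ ≤ _ := hle
    _ ≤ 2 * δ ^ 2 * ((∫ p in R, ‖u p‖ ^ 2) +
        32 * (b ^ 4 + 2 * b ^ 2) * ∫ p in R, ‖u p‖ ^ 2) := by gcongr
    _ = _ := by ring

/-! ### Partial derivatives on the open cylinder and the projection `g⁺` -/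

theorem hasDerivAt_partialT {v : ℝ × ℝ → Target n} {p : ℝ × ℝ} (h : DifferentiableAt ℝ v p) :
    HasDerivAt (fun s => v (s, p.2)) (partialT v p) p.1 ∧
      partialT v p = fderiv ℝ v p (1, 0) := by
  have h1 : HasDerivAt (fun s : ℝ => (s, p.2)) ((1 : ℝ), (0 : ℝ)) p.1 :=
    (hasDerivAt_id' p.1).prodMk (hasDerivAt_const _ _)
  have h2 : HasDerivAt (fun s => v (s, p.2)) (fderiv ℝ v p (1, 0)) p.1 :=
    h.hasFDerivAt.comp_hasDerivAt_of_eq p.1 h1 rfl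
  have h3 : partialT v p = fderiv ℝ v p (1, 0) := h2.deriv
  exact ⟨h3 ▸ h2, h3⟩

theorem hasDerivAt_partialTheta {v : ℝ × ℝ → Target n} {p : ℝ × ℝ}
    (h : DifferentiableAt ℝ v p) :
    HasDerivAt (fun s => v (p.1, s)) (partialTheta v p) p.2 ∧
      partialTheta v p = fderiv ℝ v p (0, 1) := by
  have h1 : HasDerivAt (fun s : ℝ => (p.1, s)) ((0 : ℝ), (1 : ℝ)) p.2 :=
    (hasDerivAt_const _ _).prodMk (hasDerivAt_id' p.2)
  have h2 : HasDerivAt (fun s => v (p.1, s)) (fderiv ℝ v p (0, 1)) p.2 :=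
    h.hasFDerivAt.comp_hasDerivAt_of_eq p.2 h1 rfl
  have h3 : partialTheta v p = fderiv ℝ v p (0, 1) := h2.deriv
  exact ⟨h3 ▸ h2, h3⟩

theorem contDiffOn_partial {v : ℝ × ℝ → Target n} {Ω : Set (ℝ × ℝ)} (hΩ : IsOpen Ω) {k : ℕ}
    (h : ContDiffOn ℝ (k + 1 : ℕ) v Ω) :
    ContDiffOn ℝ k (partialT v) Ω ∧ ContDiffOn ℝ k (partialTheta v) Ω := by
  have hd : ∀ p ∈ Ω, DifferentiableAt ℝ v p := fun p hp =>
    (h.differentiableOn (by simp)).differentiableAt (hΩ.mem_nhds hp)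
  have hf : ContDiffOn ℝ k (fderiv ℝ v) Ω := h.fderiv_of_isOpen hΩ (by push_cast; rfl)
  exact ⟨(hf.clm_apply contDiffOn_const).congr fun p hp => (hasDerivAt_partialT (hd p hp)).2,
    (hf.clm_apply contDiffOn_const).congr fun p hp => (hasDerivAt_partialTheta (hd p hp)).2⟩

theorem continuousOn_apply {f : ℝ × ℝ → Target n} {s : Set (ℝ × ℝ)} (hf : ContinuousOn f s)
    (j : Fin n) : ContinuousOn (fun p => f p j) s :=
  (EuclideanSpace.proj (𝕜 := ℝ) j).continuous.comp_continuousOn hf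

theorem hasDerivAt_apply {f : ℝ → Target n} {f' : Target n} {t : ℝ} (hf : HasDerivAt f f' t)
    (j : Fin n) : HasDerivAt (fun s => f s j) (f' j) t :=
  (EuclideanSpace.proj (𝕜 := ℝ) j).hasFDerivAt.comp_hasDerivAt t hf

theorem IsC2OnCylinder.contDiffOn_interior {L : ℝ} {u : ℝ × ℝ → Target n}
    (h : IsC2OnCylinder L u) : ContDiffOn ℝ 2 u (Ioo 0 (3 * L) ×ˢ univ) :=
  h.contDiffOn.mono (prod_mono Ioo_subset_Icc_self le_rfl)

theorem IsC2OnCylinder.hasStripJets {L : ℝ} {u : ℝ × ℝ → Target n}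
    (h : IsC2OnCylinder L u) : HasStripJets (3 * L) u := by
  have hΩ : IsOpen (Ioo 0 (3 * L) ×ˢ (univ : Set ℝ)) := isOpen_Ioo.prod isOpen_univ
  have hu := h.contDiffOn_interior
  obtain ⟨hT, hX⟩ := contDiffOn_partial hΩ (k := 1) hu
  obtain ⟨hTT, -⟩ := contDiffOn_partial hΩ (k := 0) hT
  obtain ⟨-, hXX⟩ := contDiffOn_partial hΩ (k := 0) hX
  have diff : ∀ {v : ℝ × ℝ → Target n} {k : ℕ}, 1 ≤ k →
      ContDiffOn ℝ k v (Ioo 0 (3 * L) ×ˢ (univ : Set ℝ)) → ∀ t ∈ Ioo 0 (3 * L), ∀ θ,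
      DifferentiableAt ℝ v (t, θ) := fun {v k} hk hv t ht θ =>
    (hv.differentiableOn (by exact_mod_cast (by lia : k ≠ 0))).differentiableAt
      (hΩ.mem_nhds ⟨ht, mem_univ _⟩)
  have dU := diff (k := 2) (by norm_num) hu
  have dT := diff le_rfl hT
  have dX := diff le_rfl hX
  refine fun j => ⟨continuousOn_apply hu.continuousOn j, continuousOn_apply hT.continuousOn j,
    continuousOn_apply hTT.continuousOn j, continuousOn_apply hX.continuousOn j,
    continuousOn_apply hXX.continuousOn j,
    fun t ht θ => hasDerivAt_apply (hasDerivAt_partialT (dU t ht θ)).1 j,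
    fun t ht θ => hasDerivAt_apply (hasDerivAt_partialT (dT t ht θ)).1 j,
    fun t ht θ => hasDerivAt_apply (hasDerivAt_partialTheta (dU t ht θ)).1 j,
    fun t ht θ => hasDerivAt_apply (hasDerivAt_partialTheta (dX t ht θ)).1 j,
    fun t ht => ?_, fun t ht => ?_⟩
  · have := h.periodic t (Ioo_subset_Icc_self ht) 0
    rw [zero_add] at this
    rw [this]
  · have hp : (fun s => u (t, s + 2 * Real.pi)) = fun s => u (t, s) :=
      funext fun s => h.periodic t (Ioo_subset_Icc_self ht) s
    have h2 := deriv_comp_add_const (fun s => u (t, s)) (2 * Real.pi) 0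
    rw [hp, zero_add] at h2
    simp only [partialTheta]
    rw [h2]

theorem HasStripJets.continuousOn {b : ℝ} {u : ℝ × ℝ → Target n} (h : HasStripJets b u) :
    ContinuousOn u (Ioo 0 b ×ˢ univ) ∧ ContinuousOn (partialT u) (Ioo 0 b ×ˢ univ) := by
  constructor
  · exact (PiLp.continuous_toLp 2 _).comp_continuousOn (continuousOn_pi.2 fun j => (h j).cont)
  · exact (PiLp.continuous_toLp 2 _).comp_continuousOn (continuousOn_pi.2 fun j => (h j).cont_t)

/-- The common form of the cosine and the sine coefficient, for the weight `e`. -/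
theorem HasStripJets.deriv_weighted_integral {b : ℝ} {u : ℝ × ℝ → Target n}
    (h : HasStripJets b u)
    {e : ℝ → ℝ} (he : Continuous e) {c : ℝ} (hc : c ∈ Ioo 0 b) (m : ℕ) (j : Fin n) :
    (deriv (fun t => (1 / Real.pi) • ∫ θ in (0 : ℝ)..(2 * Real.pi), e θ • u (t, θ)) c +
      (m : ℝ) • (1 / Real.pi) • ∫ θ in (0 : ℝ)..(2 * Real.pi), e θ • u (c, θ)) j =
    1 / Real.pi * ∫ θ in (0 : ℝ)..(2 * Real.pi), e θ * (partialT u (c, θ) j + m * u (c, θ) j) := by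
  obtain ⟨hu, hT⟩ := h.continuousOn
  have dU : ∀ t ∈ Ioo 0 b, ∀ θ, HasDerivAt (fun s => u (s, θ)) (partialT u (t, θ)) t := by
    intro t ht θ
    have : HasDerivAt (fun s => WithLp.ofLp (u (s, θ))) (WithLp.ofLp (partialT u (t, θ))) t :=
      hasDerivAt_pi.2 fun j => (h j).deriv_t t ht θ
    exact (PiLp.continuousLinearEquiv 2 ℝ fun _ : Fin n => ℝ).symm.hasFDerivAt.comp_hasDerivAt
      t this
  have ce : ContinuousOn (fun p : ℝ × ℝ => e p.2) (Ioo 0 b ×ˢ univ) :=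
    (he.comp continuous_snd).continuousOn
  have hd := (hasDerivAt_circleIntegral (F := fun p => e p.2 • u p)
    (F' := fun p => e p.2 • partialT u p) (ce.smul hu) (ce.smul hT)
    (fun t ht θ => (dU t ht θ).const_smul (e θ)) hc).const_smul (1 / Real.pi)
  have c1 : Continuous fun θ => e θ • u (c, θ) := continuous_slice (ce.smul hu) hc
  have c2 : Continuous fun θ => e θ • partialT u (c, θ) := continuous_slice (ce.smul hT) hc
  have i1 := c1.intervalIntegrable (μ := volume) 0 (2 * Real.pi)
  have i2 := c2.intervalIntegrable (μ := volume) 0 (2 * Real.pi)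
  have i1' : IntervalIntegrable (fun θ => (m : ℝ) • e θ • u (c, θ)) volume 0 (2 * Real.pi) :=
    (c1.const_smul (m : ℝ)).intervalIntegrable _ _
  have hd' : deriv (fun t => (1 / Real.pi) • ∫ θ in (0 : ℝ)..(2 * Real.pi), e θ • u (t, θ)) c =
    (1 / Real.pi) • ∫ θ in (0 : ℝ)..(2 * Real.pi), e θ • partialT u (c, θ) := hd.deriv
  rw [hd', smul_comm (m : ℝ), ← smul_add, ← intervalIntegral.integral_smul,
    ← intervalIntegral.integral_add i2 i1']
  have i3 : IntervalIntegrable (fun θ => e θ • partialT u (c, θ) + (m : ℝ) • e θ • u (c, θ))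
      volume 0 (2 * Real.pi) := i2.add i1'
  have := (EuclideanSpace.proj j : Target n →L[ℝ] ℝ).intervalIntegral_comp_comm i3
  rw [PiLp.smul_apply, smul_eq_mul]
  congr 1
  refine Eq.trans this.symm (intervalIntegral.integral_congr fun θ _ => ?_)
  change e θ * partialT u (c, θ) j + m * (e θ * u (c, θ) j) = _
  ring

theorem norm_sq_angularCoeff {g : ℝ → ℝ} (hg : Continuous g) (k : ℤ) :
    ‖angularCoeff k g‖ ^ 2 =
      1 / 4 * ((1 / Real.pi * ∫ θ in (0 : ℝ)..(2 * Real.pi), Real.cos (k * θ) * g θ) ^ 2 +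
        (1 / Real.pi * ∫ θ in (0 : ℝ)..(2 * Real.pi), Real.sin (k * θ) * g θ) ^ 2) := by
  set A := ∫ θ in (0 : ℝ)..(2 * Real.pi), Real.cos (k * θ) * g θ with hA
  set B := ∫ θ in (0 : ℝ)..(2 * Real.pi), Real.sin (k * θ) * g θ with hB
  have hc : Continuous fun θ => Real.cos (k * θ) * g θ := by fun_prop
  have hs : Continuous fun θ => Real.sin (k * θ) * g θ := by fun_prop
  have e : ∫ θ in (0 : ℝ)..(2 * Real.pi), wave k θ * g θ = A - B * Complex.I := by
    rw [hA, hB, ← intervalIntegral.integral_ofReal, ← intervalIntegral.integral_ofReal,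
      ← intervalIntegral.integral_mul_const, ← intervalIntegral.integral_sub]
    · refine intervalIntegral.integral_congr fun θ _ => ?_
      simp only [wave]
      rw [← neg_mul, Complex.exp_mul_I, Complex.cos_neg, Complex.sin_neg]
      push_cast
      ring
    · exact (Complex.continuous_ofReal.comp hc).intervalIntegrable _ _
    · exact ((Complex.continuous_ofReal.comp hs).mul continuous_const).intervalIntegrable _ _
  have e2 : angularCoeff k g = (1 / (2 * Real.pi) * A : ℝ) + (-(1 / (2 * Real.pi) * B) : ℝ) *
      Complex.I := by
    rw [angularCoeff, e]; push_cast; ring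
  rw [e2, Complex.sq_norm, Complex.normSq_add_mul_I]
  have := Real.pi_ne_zero
  field_simp
  ring

/-- The real pair `g⁺` and the complex coefficients of order `±m` measure the same quantity, up to
the factor `1 / 2`. -/
theorem HasStripJets.sum_resonantSize_sq {b : ℝ} {u : ℝ × ℝ → Target n} (h : HasStripJets b u)
    {c : ℝ} (hc : c ∈ Ioo 0 b) (m : ℕ) :
    ∑ j, (resonantSize m (fun p => u p j) (fun p => partialT u p j) c m ^ 2 +
        resonantSize m (fun p => u p j) (fun p => partialT u p j) c (-m) ^ 2) =
      1 / 2 * (Real.exp (-(m * c)) ^ 2 * (‖(gPlus m u c).1‖ ^ 2 + ‖(gPlus m u c).2‖ ^ 2)) := by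
  rw [EuclideanSpace.real_norm_sq_eq, EuclideanSpace.real_norm_sq_eq, ← Finset.sum_add_distrib,
    Finset.mul_sum, Finset.mul_sum]
  refine Finset.sum_congr rfl fun j _ => ?_
  have g1 := h.deriv_weighted_integral (e := fun θ => Real.cos (m * θ)) (by fun_prop) hc m j
  have g2 := h.deriv_weighted_integral (e := fun θ => Real.sin (m * θ)) (by fun_prop) hc m j
  have e1 : (gPlus m u c).1 j = 1 / Real.pi * ∫ θ in (0 : ℝ)..(2 * Real.pi),
      Real.cos (m * θ) * (partialT u (c, θ) j + m * u (c, θ) j) := g1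
  have e2 : (gPlus m u c).2 j = 1 / Real.pi * ∫ θ in (0 : ℝ)..(2 * Real.pi),
      Real.sin (m * θ) * (partialT u (c, θ) j + m * u (c, θ) j) := g2
  have cT : Continuous fun θ => partialT u (c, θ) j := continuous_slice (h j).cont_t hc
  have cU : Continuous fun θ => (m : ℝ) * u (c, θ) j :=
    continuous_const.mul (continuous_slice (h j).cont hc)
  have cTU : Continuous fun θ => partialT u (c, θ) j + (m : ℝ) * u (c, θ) j := cT.add cU
  have er : ∀ k : ℤ, resonantSize m (fun p => u p j) (fun p => partialT u p j) c k =
      Real.exp (-(m * c)) * ‖angularCoeff k fun θ => partialT u (c, θ) j + m * u (c, θ) j‖ := by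
    intro k
    rw [resonantSize, angularCoeff_add k cT cU]
    congr 3
    simp only [angularCoeff]
    rw [mul_left_comm, ← intervalIntegral.integral_const_mul]
    congr 2
    ext θ
    push_cast
    ring
  rw [er, er, mul_pow, mul_pow, norm_sq_angularCoeff cTU, norm_sq_angularCoeff cTU,
    e1, e2]
  push_cast
  simp only [neg_mul, Real.cos_neg, Real.sin_neg, intervalIntegral.integral_neg]
  ring

/-! ### Energies on the three pieces -/

theorem setIntegral_eq_sum_sliceEnergy {b : ℝ} {u : ℝ × ℝ → Target n}
    (hu : ContinuousOn u (Icc 0 b ×ˢ univ)) (m : ℕ) {α β : ℝ} (hα : 0 ≤ α) (hαβ : α ≤ β)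
    (hβ : β ≤ b) :
    ∫ p in Icc α β ×ˢ Icc 0 (2 * Real.pi), ‖u p‖ ^ 2 * Real.exp (-(2 * (m : ℝ) * p.1)) =
      ∑ j, ∫ t in α..β, sliceEnergy m (fun p => u p j) t := by
  have hsub : Icc α β ×ˢ Icc 0 (2 * Real.pi) ⊆ Icc 0 b ×ˢ univ :=
    prod_mono (Icc_subset_Icc hα hβ) (subset_univ _)
  have hc : ∀ j, ContinuousOn (fun p : ℝ × ℝ => u p j ^ 2 * Real.exp (-(2 * (m : ℝ) * p.1)))
      (Icc α β ×ˢ Icc 0 (2 * Real.pi)) := fun j =>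
    (((continuousOn_apply hu j).mono hsub).pow 2).mul (Continuous.continuousOn (by fun_prop))
  simp only [EuclideanSpace.real_norm_sq_eq, Finset.sum_mul]
  rw [integral_finsetSum _ fun j _ => (hc j).integrableOn_compact
    (isCompact_Icc.prod isCompact_Icc)]
  refine Finset.sum_congr rfl fun j _ => ?_
  rw [setIntegral_rectangle hαβ (hc j)]
  refine intervalIntegral.integral_congr fun t _ => ?_
  simp only [sliceEnergy]
  rw [intervalIntegral.integral_mul_const, mul_comm]

theorem IsC2OnCylinder.energy_eq {L : ℝ} (hL : 0 ≤ L) {u : ℝ × ℝ → Target n}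
    (h : IsC2OnCylinder L u) (m : ℕ) {i : ℕ} (hi : i ∈ Icc 1 3) :
    energy m L u i =
      ∑ j, ∫ t in (((i : ℝ) - 1) * L)..(i * L), sliceEnergy m (fun p => u p j) t := by
  have h1 : (1 : ℝ) ≤ i := by exact_mod_cast hi.1
  have h3 : (i : ℝ) ≤ 3 := by exact_mod_cast hi.2
  exact setIntegral_eq_sum_sliceEnergy h.contDiffOn.continuousOn m
    (mul_nonneg (by linarith) hL) (by linarith) (by gcongr)

theorem energy_nonneg (m : ℕ) (L : ℝ) (u : ℝ × ℝ → Target n) (i : ℕ) : 0 ≤ energy m L u i :=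
  integral_nonneg fun _ => by positivity

theorem IsC2OnCylinder.sum_energy {L : ℝ} (hL : 0 ≤ L) {u : ℝ × ℝ → Target n}
    (h : IsC2OnCylinder L u) (m : ℕ) :
    energy m L u 1 + energy m L u 2 + energy m L u 3 =
      ∑ j, ∫ t in (0 : ℝ)..(3 * L), sliceEnergy m (fun p => u p j) t := by
  rw [h.energy_eq hL m ⟨le_rfl, by norm_num⟩, h.energy_eq hL m ⟨by norm_num, by norm_num⟩,
    h.energy_eq hL m ⟨by norm_num, le_rfl⟩, ← Finset.sum_add_distrib, ← Finset.sum_add_distrib]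
  refine Finset.sum_congr rfl fun j _ => ?_
  have hc : ContinuousOn (sliceEnergy m fun p => u p j) (Icc 0 (3 * L)) :=
    continuousOn_sliceEnergy m (continuousOn_apply h.contDiffOn.continuousOn j)
  have hi : ∀ x ∈ Icc 0 (3 * L), ∀ y ∈ Icc 0 (3 * L),
      IntervalIntegrable (sliceEnergy m fun p => u p j) volume x y := fun x hx y hy =>
    (hc.mono (ordConnected_Icc.uIcc_subset hx hy)).intervalIntegrable
  have e0 : (((1 : ℕ) : ℝ) - 1) * L = 0 := by norm_num
  have e1 : ((1 : ℕ) : ℝ) * L = L := by norm_num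
  have e2 : (((2 : ℕ) : ℝ) - 1) * L = L := by norm_num
  have e3 : (((3 : ℕ) : ℝ) - 1) * L = ((2 : ℕ) : ℝ) * L := by norm_num
  have e4 : ((3 : ℕ) : ℝ) * L = 3 * L := by norm_num
  have m0 : (0 : ℝ) ∈ Icc 0 (3 * L) := ⟨le_rfl, by linarith⟩
  have m1 : L ∈ Icc 0 (3 * L) := ⟨by linarith, by linarith⟩
  have m2 : ((2 : ℕ) : ℝ) * L ∈ Icc 0 (3 * L) := ⟨by positivity, by push_cast; linarith⟩
  have m3 : 3 * L ∈ Icc 0 (3 * L) := ⟨by linarith, le_rfl⟩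
  rw [e0, e1, e2, e3, e4, intervalIntegral.integral_add_adjacent_intervals (hi _ m0 _ m1)
    (hi _ m1 _ m2), intervalIntegral.integral_add_adjacent_intervals (hi _ m0 _ m2) (hi _ m2 _ m3)]

theorem gam_sq (m : ℕ) (L : ℝ) (u : ℝ × ℝ → Target n) (i : ℕ) :
    gam m L u i ^ 2 = Real.exp (-(m * ((2 * (i : ℝ) - 1) * L / 2))) ^ 2 *
      (‖(gPlus m u ((2 * (i : ℝ) - 1) * L / 2)).1‖ ^ 2 +
        ‖(gPlus m u ((2 * (i : ℝ) - 1) * L / 2)).2‖ ^ 2) := by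
  rw [gam, mul_pow, Real.sq_sqrt (by positivity), mul_comm]

/-- If `w` vanishes near the circle at `c`, so do its Fourier coefficients and their derivatives. -/
theorem IsStripJet.resonantSize_eq_zero {b : ℝ} {w wt wtt wx wxx : ℝ × ℝ → ℝ}
    (h : IsStripJet b w wt wtt wx wxx) (m : ℕ) {α β c : ℝ} (hc : c ∈ Ioo α β)
    (hcb : c ∈ Ioo 0 b) (h0 : ∀ t ∈ Ioo α β, t ∈ Ioo 0 b → sliceEnergy m w t = 0) (k : ℤ) :
    resonantSize m w wt c k = 0 := by
  have hz : ∀ t ∈ Ioo α β, t ∈ Ioo 0 b → angularCoeff k (fun θ => w (t, θ)) = 0 := by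
    intro t ht htb
    have hs := hasSum_sliceEnergy m (continuous_slice h.cont htb)
    rw [h0 t ht htb, mul_zero, hasSum_zero_iff_of_nonneg fun _ => sq_nonneg _] at hs
    have := congrFun hs k
    simpa [Real.exp_ne_zero] using this
  have hd := (h.isModeSolution k).deriv_fst c hcb
  have hev : (fun t => angularCoeff k fun θ => w (t, θ)) =ᶠ[nhds c] fun _ => (0 : ℂ) := by
    filter_upwards [Ioo_mem_nhds hc.1 hc.2, Ioo_mem_nhds hcb.1 hcb.2] with t h1 h2
    exact hz t h1 h2
  have h2 := hd.unique ((hasDerivAt_const c (0 : ℂ)).congr_of_eventuallyEq hev)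
  rw [resonantSize, h2, hz c hc hcb]
  simp

/-- The hypothesis on `λ_i` in terms of `γ_i` and `E_i`. If `E_i = 0`, where `λ_i` is `0` by
convention, then `u` vanishes on `Q_i` and `γ_i` is `0` as well. -/
theorem IsC2OnCylinder.gam_sq_le {L : ℝ} (hL : 0 < L) {u : ℝ × ℝ → Target n}
    (h : IsC2OnCylinder L u) (m : ℕ) {i : ℕ} (hi : i ∈ Icc 1 3) {ε : ℝ}
    (hlam : lam m L u i ≤ ε) : gam m L u i ^ 2 ≤ ε ^ 2 * energy m L u i := by
  have h1 : (1 : ℝ) ≤ i := by exact_mod_cast hi.1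
  have h3 : (i : ℝ) ≤ 3 := by exact_mod_cast hi.2
  by_cases hE : energy m L u i = 0
  · rw [hE, mul_zero]
    refine le_of_eq ?_
    set c := (2 * (i : ℝ) - 1) * L / 2 with hcdef
    have hα : 0 ≤ ((i : ℝ) - 1) * L := mul_nonneg (by linarith) hL.le
    have hβ : (i : ℝ) * L ≤ 3 * L := by gcongr
    have hc : c ∈ Ioo (((i : ℝ) - 1) * L) (i * L) := ⟨by linarith, by linarith⟩
    have hcb : c ∈ Ioo 0 (3 * L) := ⟨hα.trans_lt hc.1, hc.2.trans_le hβ⟩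
    have hαβ : ((i : ℝ) - 1) * L ≤ i * L := by linarith
    rw [h.energy_eq hL.le m hi, Finset.sum_eq_zero_iff_of_nonneg fun j _ =>
      intervalIntegral.integral_nonneg hαβ fun _ _ => sliceEnergy_nonneg m _ _] at hE
    have hz : ∀ j, ∀ t ∈ Ioo (((i : ℝ) - 1) * L) (i * L), t ∈ Ioo 0 (3 * L) →
        sliceEnergy m (fun p => u p j) t = 0 := by
      intro j t ht _
      have hcont : ContinuousOn (sliceEnergy m fun p => u p j)
          (Icc (((i : ℝ) - 1) * L) (i * L)) :=
        (continuousOn_sliceEnergy m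
          (continuousOn_apply h.contDiffOn.continuousOn j)).mono (Icc_subset_Icc hα hβ)
      have hint : IntervalIntegrable (sliceEnergy m fun p => u p j) volume
          (((i : ℝ) - 1) * L) (i * L) := by
        refine ContinuousOn.intervalIntegrable ?_
        rwa [uIcc_of_le hαβ]
      have hae := (intervalIntegral.integral_eq_zero_iff_of_le_of_nonneg_ae hαβ
        (Filter.Eventually.of_forall fun t => sliceEnergy_nonneg m _ t) hint).1
        (hE j (Finset.mem_univ _))
      rw [restrict_Ioc_eq_restrict_Icc] at hae
      exact Measure.eqOn_Icc_of_ae_eq volume (by linarith [hc.1, hc.2]) hae hcont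
        continuousOn_const (Ioo_subset_Icc_self ht)
    have hs := h.hasStripJets.sum_resonantSize_sq hcb m
    rw [Finset.sum_eq_zero fun j _ => by
      rw [(h.hasStripJets j).resonantSize_eq_zero m hc hcb (hz j),
        (h.hasStripJets j).resonantSize_eq_zero m hc hcb (hz j)]; norm_num] at hs
    rw [gam_sq]
    linarith
  · have hpos : 0 < energy m L u i := lt_of_le_of_ne (energy_nonneg m L u i) (Ne.symm hE)
    rw [lam, if_neg hE, div_le_iff₀ (Real.sqrt_pos.2 hpos)] at hlam
    have hg : 0 ≤ gam m L u i := mul_nonneg (Real.sqrt_nonneg _) (Real.exp_pos _).le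
    calc gam m L u i ^ 2 ≤ (ε * Real.sqrt (energy m L u i)) ^ 2 := pow_le_pow_left₀ hg hlam 2
      _ = ε ^ 2 * energy m L u i := by rw [mul_pow, Real.sq_sqrt hpos.le]

theorem mem_cylinder {L : ℝ} {p : ℝ × ℝ} (hp : p ∈ Icc 0 (3 * L) ×ˢ Icc 0 (2 * Real.pi)) :
    p ∈ cylinder L := by
  obtain ⟨⟨h0, h3⟩, hθ⟩ := hp
  rcases le_total p.1 L with h1 | h1
  · exact Or.inl (Or.inl ⟨⟨by simpa using h0, by simpa using h1⟩, hθ⟩)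
  rcases le_total p.1 (2 * L) with h2 | h2
  · exact Or.inl (Or.inr ⟨⟨by push_cast; linarith, by simpa using h2⟩, hθ⟩)
  · exact Or.inr ⟨⟨by push_cast; linarith, by push_cast; linarith⟩, hθ⟩

/-- The differential inequality with the constant `δ` in place of `ω`. The bound on `ω` holds almost
everywhere, and the null set `θ = 2π` is discarded. -/
theorem SolvesWithBound.ae_norm_laplace_le {L : ℝ} {u : ℝ × ℝ → Target n}
    {φ : ℝ × ℝ → Target n → Target n × Target n → Target n} {ω : ℝ × ℝ → ℝ}
    (h : SolvesWithBound L u φ ω) {δ : ℝ} (hδ : 0 < δ)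
    (hω : eLpNorm ω ⊤ (volume.restrict (cylinder L)) < ENNReal.ofReal δ) {α β : ℝ}
    (hα : 0 < α) (hβ : β < 3 * L) :
    ∀ᵐ p ∂volume.restrict (Icc α β ×ˢ Icc 0 (2 * Real.pi)),
      ‖laplace u p‖ ≤ δ * (‖u p‖ + gradNorm u p) := by
  have hsub : Icc α β ×ˢ Icc 0 (2 * Real.pi) ⊆ cylinder L := fun p hp =>
    mem_cylinder ⟨⟨hα.le.trans hp.1.1, hp.1.2.trans hβ.le⟩, hp.2⟩
  have hae : ∀ᵐ p ∂volume.restrict (cylinder L), ω p ≤ δ := by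
    rw [eLpNorm_exponent_top] at hω
    filter_upwards [ae_le_eLpNormEssSup (f := ω)] with p hp
    have h2 := hp.trans_lt hω
    rw [Real.enorm_eq_ofReal_abs, ENNReal.ofReal_lt_ofReal_iff hδ] at h2
    exact (le_abs_self _).trans h2.le
  have hIco : volume.restrict (Icc α β ×ˢ Icc 0 (2 * Real.pi)) =
      volume.restrict (Icc α β ×ˢ Ico 0 (2 * Real.pi)) := by
    rw [Measure.volume_eq_prod, ← Measure.prod_restrict, ← Measure.prod_restrict,
      restrict_Ico_eq_restrict_Icc]
  have hae' := ae_restrict_of_ae_restrict_of_subset hsub hae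
  rw [hIco] at hae' ⊢
  filter_upwards [hae', ae_restrict_mem (measurableSet_Icc.prod measurableSet_Ico)] with p hp hpR
  have hmem : p ∈ openCylinder L :=
    ⟨⟨hα.trans_le hpR.1.1, hpR.1.2.trans_lt hβ⟩, hpR.2⟩
  rw [h.equation p hmem]
  refine (h.bound p hmem).trans (mul_le_mul_of_nonneg_right hp ?_)
  exact add_nonneg (norm_nonneg _) (gradNorm_nonneg _ _)

theorem HasStripJets.sum_integral_laplace {b : ℝ} (hb : 2 ≤ b) {u : ℝ × ℝ → Target n}
    (h : HasStripJets b u) :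
    ∑ j, ∫ r in (1 : ℝ)..(b - 1), ∫ θ in (0 : ℝ)..(2 * Real.pi),
      (partialT (partialT u) (r, θ) j + partialTheta (partialTheta u) (r, θ) j) ^ 2 =
    ∫ p in Icc 1 (b - 1) ×ˢ Icc 0 (2 * Real.pi), ‖laplace u p‖ ^ 2 := by
  have hR : Icc 1 (b - 1) ×ˢ Icc 0 (2 * Real.pi) ⊆ Ioo 0 b ×ˢ univ := prod_mono
    (fun t ht => ⟨by linarith [ht.1], by linarith [ht.2]⟩) (subset_univ _)
  have hc : ∀ j, ContinuousOn (fun p => (partialT (partialT u) p j +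
      partialTheta (partialTheta u) p j) ^ 2) (Icc 1 (b - 1) ×ˢ Icc 0 (2 * Real.pi)) := fun j =>
    (((h j).cont_tt.mono hR).add ((h j).cont_xx.mono hR)).pow 2
  simp only [EuclideanSpace.real_norm_sq_eq, laplace, PiLp.add_apply]
  rw [integral_finsetSum _ fun j _ => (hc j).integrableOn_compact
    (isCompact_Icc.prod isCompact_Icc)]
  exact Finset.sum_congr rfl fun j _ => (setIntegral_rectangle (by linarith) (hc j)).symm

theorem IsC2OnCylinder.integral_norm_sq_le {L : ℝ} (hL : 1 ≤ L) {u : ℝ × ℝ → Target n}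
    (h : IsC2OnCylinder L u) (m : ℕ) :
    ∫ p in Icc (1 / 2) (3 * L - 1 / 2) ×ˢ Icc 0 (2 * Real.pi), ‖u p‖ ^ 2 ≤
      Real.exp (6 * m * L) * (energy m L u 1 + energy m L u 2 + energy m L u 3) := by
  rw [h.sum_energy (by linarith) m, ← setIntegral_eq_sum_sliceEnergy h.contDiffOn.continuousOn m
    le_rfl (by linarith) le_rfl, ← integral_const_mul]
  have hsub : Icc (1 / 2) (3 * L - 1 / 2) ×ˢ Icc 0 (2 * Real.pi) ⊆
      Icc 0 (3 * L) ×ˢ Icc 0 (2 * Real.pi) :=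
    prod_mono (Icc_subset_Icc (by norm_num) (by linarith)) le_rfl
  have hK : IsCompact (Icc 0 (3 * L) ×ˢ Icc 0 (2 * Real.pi)) := isCompact_Icc.prod isCompact_Icc
  have hu : ContinuousOn (fun p => ‖u p‖ ^ 2) (Icc 0 (3 * L) ×ˢ Icc 0 (2 * Real.pi)) :=
    ((h.contDiffOn.continuousOn.mono (prod_mono le_rfl (subset_univ _))).norm).pow 2
  have i1 := hu.integrableOn_compact (μ := volume) hK
  have i2 : IntegrableOn (fun p : ℝ × ℝ => Real.exp (6 * m * L) *
      (‖u p‖ ^ 2 * Real.exp (-(2 * (m : ℝ) * p.1)))) (Icc 0 (3 * L) ×ˢ Icc 0 (2 * Real.pi)) :=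
    ContinuousOn.integrableOn_compact hK
      (continuousOn_const.mul (hu.mul (Continuous.continuousOn (by fun_prop))))
  calc _ ≤ ∫ p in Icc 0 (3 * L) ×ˢ Icc 0 (2 * Real.pi), ‖u p‖ ^ 2 :=
        setIntegral_mono_set i1 (Filter.Eventually.of_forall fun p => sq_nonneg _)
          hsub.eventuallyLE
    _ ≤ _ := by
        refine setIntegral_mono_on i1 i2 (measurableSet_Icc.prod measurableSet_Icc) ?_
        rintro p ⟨⟨-, hp⟩, -⟩
        have : 1 ≤ Real.exp (6 * m * L) * Real.exp (-(2 * (m : ℝ) * p.1)) := by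
          rw [← Real.exp_add]
          refine Real.one_le_exp ?_
          have : (m : ℝ) * p.1 ≤ m * (3 * L) := by gcongr
          linarith
        calc ‖u p‖ ^ 2 ≤ ‖u p‖ ^ 2 * (Real.exp (6 * m * L) * Real.exp (-(2 * (m : ℝ) * p.1))) :=
              le_mul_of_one_le_right (sq_nonneg _) this
          _ = _ := by ring

/-- The three-circle estimate with explicit constants. All three energies stand on the right. -/
theorem IsC2OnCylinder.energy_two_le {L : ℝ} (hL : 2 ≤ L) {u : ℝ × ℝ → Target n}
    (h : IsC2OnCylinder L u) {m : ℕ} (hm : 1 ≤ m) {δ ε : ℝ} (hδ : δ ≤ 1 / 2)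
    (hΔ : ∀ᵐ p ∂volume.restrict (Icc (1 / 2) (3 * L - 1 / 2) ×ˢ Icc 0 (2 * Real.pi)),
      ‖laplace u p‖ ≤ δ * (‖u p‖ + gradNorm u p))
    {i : ℕ} (hi : i ∈ Icc 1 3) (hγ : gam m L u i ^ 2 ≤ ε ^ 2 * energy m L u i) :
    energy m L u 2 ≤ (15 * (2 * Real.exp m * (L - 1) * Real.exp (-(L - 1))) ^ 2 +
      120 * L ^ 4 * (1 + 32 * ((3 * L) ^ 4 + 2 * (3 * L) ^ 2)) * Real.exp (6 * m * L) * δ ^ 2 +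
      20 * Real.pi * L ^ 3 * ε ^ 2) *
      (energy m L u 1 + energy m L u 2 + energy m L u 3) := by
  have h1 : (1 : ℝ) ≤ i := by exact_mod_cast hi.1
  have h3 : (i : ℝ) ≤ 3 := by exact_mod_cast hi.2
  have hJ := h.hasStripJets
  set c := (2 * (i : ℝ) - 1) * L / 2 with hcdef
  have hc : c ∈ Icc 1 (3 * L - 1) := ⟨by nlinarith, by nlinarith⟩
  have hc' : c ∈ Ioo 0 (3 * L) := ⟨by linarith [hc.1], by linarith [hc.2]⟩
  have hsum := Finset.sum_le_sum fun j (_ : j ∈ Finset.univ) =>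
    (hJ j).integral_sliceEnergy_le hL (continuousOn_apply h.contDiffOn.continuousOn j) hm hc
  have e2 := h.energy_eq (by linarith) m (i := 2) ⟨by norm_num, by norm_num⟩
  have e2' : ((((2 : ℕ) : ℝ)) - 1) * L = L := by norm_num
  rw [e2', Nat.cast_ofNat] at e2
  rw [← e2, Finset.sum_add_distrib, ← Finset.mul_sum, ← Finset.mul_sum, Finset.sum_add_distrib,
    ← Finset.mul_sum, ← Finset.mul_sum, ← h.sum_energy (by linarith) m,
    hJ.sum_integral_laplace (by linarith), hJ.sum_resonantSize_sq hc' m, ← gam_sq] at hsum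
  have hlap := hJ.integral_laplace_sq_le (by linarith) hδ hΔ
  have hu := h.integral_norm_sq_le (by linarith) m
  have hEi : energy m L u i ≤ energy m L u 1 + energy m L u 2 + energy m L u 3 := by
    have n1 := energy_nonneg m L u 1
    have n2 := energy_nonneg m L u 2
    have n3 := energy_nonneg m L u 3
    obtain ⟨hi1, hi3⟩ := hi
    interval_cases i <;> linarith
  set E := energy m L u 1 + energy m L u 2 + energy m L u 3
  have hπ := Real.pi_pos
  have a1 : ∫ p in Icc 1 (3 * L - 1) ×ˢ Icc 0 (2 * Real.pi), ‖laplace u p‖ ^ 2 ≤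
      2 * δ ^ 2 * (1 + 32 * ((3 * L) ^ 4 + 2 * (3 * L) ^ 2)) * (Real.exp (6 * m * L) * E) :=
    hlap.trans (by gcongr)
  have a2 : gam m L u i ^ 2 ≤ ε ^ 2 * E := hγ.trans (by gcongr)
  calc energy m L u 2 ≤ _ := hsum
    _ ≤ 15 * (2 * Real.exp m * (L - 1) * Real.exp (-(L - 1))) ^ 2 * E + 20 * L ^ 3 * (3 * L *
        (2 * δ ^ 2 * (1 + 32 * ((3 * L) ^ 4 + 2 * (3 * L) ^ 2)) * (Real.exp (6 * m * L) * E)) +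
        2 * Real.pi * (1 / 2 * (ε ^ 2 * E))) := by gcongr
    _ = _ := by ring

/-! ### Choice of the constants -/

/-- This is where `q < 2` is used: the factor of the three-circle estimate is of order `L² e^{-2L}`.
-/
theorem exists_decay_threshold (m : ℕ) {q : ℝ} (hq : q < 2) :
    ∃ L₀ : ℝ, 2 ≤ L₀ ∧ ∀ L, L₀ < L →
      15 * (2 * Real.exp m * (L - 1) * Real.exp (-(L - 1))) ^ 2 ≤
        1 / 4 * Real.exp (-(q * L)) := by
  have hlim : Filter.Tendsto (fun L : ℝ => 240 * Real.exp m ^ 2 * Real.exp 2 / (2 - q) ^ 2 *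
      (((2 - q) * L) ^ 2 * Real.exp (-((2 - q) * L)))) Filter.atTop (nhds 0) := by
    have h1 := (Real.tendsto_pow_mul_exp_neg_atTop_nhds_zero 2).comp
      (Filter.tendsto_id.const_mul_atTop (by linarith : 0 < 2 - q))
    simpa using h1.const_mul (240 * Real.exp m ^ 2 * Real.exp 2 / (2 - q) ^ 2)
  obtain ⟨L₁, hL₁⟩ := Filter.eventually_atTop.1 (hlim.eventually_le_const (zero_lt_one))
  refine ⟨max 2 L₁, le_max_left _ _, fun L hL => ?_⟩
  have hL2 : 2 < L := (le_max_left _ _).trans_lt hL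
  have h1 := hL₁ L ((le_max_right _ _).trans hL.le)
  have hq' : 2 - q ≠ 0 := by linarith
  have e1 : Real.exp (-(L - 1)) ^ 2 =
      Real.exp 2 * (Real.exp (-((2 - q) * L)) * Real.exp (-(q * L))) := by
    rw [← Real.exp_nat_mul, ← Real.exp_add, ← Real.exp_add]; congr 1; push_cast; ring
  have h2 : (L - 1) ^ 2 ≤ L ^ 2 := pow_le_pow_left₀ (by linarith) (by linarith) 2
  calc 15 * (2 * Real.exp m * (L - 1) * Real.exp (-(L - 1))) ^ 2
      = 60 * Real.exp m ^ 2 * (L - 1) ^ 2 * Real.exp (-(L - 1)) ^ 2 := by ring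
    _ ≤ 60 * Real.exp m ^ 2 * L ^ 2 * Real.exp (-(L - 1)) ^ 2 := by gcongr
    _ = 1 / 4 * (240 * Real.exp m ^ 2 * Real.exp 2 / (2 - q) ^ 2 *
        (((2 - q) * L) ^ 2 * Real.exp (-((2 - q) * L)))) * Real.exp (-(q * L)) := by
        rw [e1]; field_simp; ring
    _ ≤ 1 / 4 * 1 * Real.exp (-(q * L)) := by gcongr
    _ = _ := by ring

theorem exists_pos_mul_sq_le {A B : ℝ} (hA : 0 < A) (hB : 0 < B) :
    ∃ x : ℝ, 0 < x ∧ x ≤ 1 / 2 ∧ A * x ^ 2 ≤ B := by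
  refine ⟨min (1 / 2) (Real.sqrt (B / A)), by positivity, min_le_left _ _, ?_⟩
  have h1 : (min (1 / 2) (Real.sqrt (B / A))) ^ 2 ≤ B / A := by
    calc _ ≤ Real.sqrt (B / A) ^ 2 := pow_le_pow_left₀ (by positivity) (min_le_right _ _) 2
      _ = B / A := Real.sq_sqrt (by positivity)
  calc _ ≤ A * (B / A) := by gcongr
    _ = B := by field_simp

end ThreeCircle

end

theorem theorem2p7 (m : ℕ) (hm : 1 ≤ m) (q : ℝ) (hq : q ∈ Set.Ioo (0 : ℝ) 2) :
    ∃ L₀ : ℝ, 0 < L₀ ∧ ∀ L : ℝ, L₀ < L →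
      ∃ ε₁ δ₀ : ℝ, 0 < ε₁ ∧ 0 < δ₀ ∧
        ∀ (n : ℕ) (u : ℝ × ℝ → ThreeCircle.Target n)
          (φ : ℝ × ℝ → ThreeCircle.Target n → ThreeCircle.Target n × ThreeCircle.Target n →
            ThreeCircle.Target n)
          (ω : ℝ × ℝ → ℝ),
          ThreeCircle.IsC2OnCylinder L u →
          (∀ p ∈ ThreeCircle.cylinder L, 0 ≤ ω p) →
          ThreeCircle.SolvesWithBound L u φ ω →
          MeasureTheory.eLpNorm ω ⊤
            (MeasureTheory.volume.restrict (ThreeCircle.cylinder L)) < ENNReal.ofReal δ₀ →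
          min (min (ThreeCircle.lam m L u 1) (ThreeCircle.lam m L u 2))
            (ThreeCircle.lam m L u 3) ≤ ε₁ →
          ThreeCircle.SatisfiesThreeCircle (ThreeCircle.energy m L u) q L := by
  obtain ⟨L₀, hL₀, hdecay⟩ := ThreeCircle.exists_decay_threshold m hq.2
  refine ⟨L₀, by linarith, fun L hL => ?_⟩
  have hL2 : 2 < L := hL₀.trans_lt hL
  have hexp := Real.exp_pos (-(q * L))
  have hπ := Real.pi_pos
  obtain ⟨δ₀, hδ0, hδ, hδA⟩ := ThreeCircle.exists_pos_mul_sq_le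
    (A := 120 * L ^ 4 * (1 + 32 * ((3 * L) ^ 4 + 2 * (3 * L) ^ 2)) * Real.exp (6 * m * L))
    (B := 1 / 8 * Real.exp (-(q * L))) (by positivity) (by positivity)
  obtain ⟨ε₁, hε0, -, hεA⟩ := ThreeCircle.exists_pos_mul_sq_le
    (A := 20 * Real.pi * L ^ 3) (B := 1 / 8 * Real.exp (-(q * L)))
    (by positivity) (by positivity)
  refine ⟨ε₁, δ₀, hε0, hδ0, fun n u φ ω hu _ hsol hω hlam => ?_⟩
  obtain ⟨i, hi, hlam⟩ : ∃ i ∈ Set.Icc 1 3, ThreeCircle.lam m L u i ≤ ε₁ := by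
    rcases min_le_iff.1 hlam with h | h
    · rcases min_le_iff.1 h with h | h
      · exact ⟨1, by simp, h⟩
      · exact ⟨2, by simp, h⟩
    · exact ⟨3, by simp, h⟩
  have hmain := hu.energy_two_le hL2.le hm hδ
    (hsol.ae_norm_laplace_le hδ0 hω (by norm_num) (by linarith)) hi
    (hu.gam_sq_le (by linarith) m hi hlam)
  have n1 := ThreeCircle.energy_nonneg m L u 1
  have n2 := ThreeCircle.energy_nonneg m L u 2
  have n3 := ThreeCircle.energy_nonneg m L u 3
  have hle : ThreeCircle.energy m L u 2 ≤ 1 / 2 * Real.exp (-(q * L)) *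
      (ThreeCircle.energy m L u 1 + ThreeCircle.energy m L u 2 + ThreeCircle.energy m L u 3) :=
    hmain.trans (mul_le_mul_of_nonneg_right (by linarith [hdecay L hL]) (by linarith))
  have he1 : Real.exp (-(q * L)) ≤ 1 := Real.exp_le_one_iff.2 (by nlinarith [hq.1])
  have h2 := mul_le_mul_of_nonneg_right he1 n2
  show ThreeCircle.energy m L u 2 ≤ Real.exp (-(q * L)) *
    (ThreeCircle.energy m L u 1 + ThreeCircle.energy m L u 3)
  linarith
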